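/- A stochastic shortest path (SSP) instance consists of a known finite Markov decision process (MDP) with state set $\mathcal S$, $|\mathcal S|=S$, initial state $s_0$, goal state $g\notin\mathcal S$, action sets $\mathcal A_s$, transition function $P$, and of cost functions $c_1,\dots,c_K$ assigning to each pair $(s,a)$ with $a\in\mathcal A_s$ a cost in $[0,1]$. Let $A=\frac1S\sum_{s}|\mathcal A_s|$ be the average number of actions. A deterministic stationary policy $\pi$ is proper if from every state it reaches $g$ with probability $1$; $T^\pi(s)$ is its expected hitting time of $g$ from $s$ and $J_k^\pi(s)$ its expected total cost under $c_k$ from $s$. The diameter of the MDP is $\max_s\min_{\pi\text{ proper}}T^\pi(s)$. In each of $K$ episodes a (possibly randomized) learner, who knows the MDP, starts at $s_0$ and selects actions until $g$ is reached; under bandit feedback, only after reaching $g$ does she observe the costs $c_k$ of the state-action pairs visited in that episode. Her expected regret is $$\mathbb E[R_K]=\mathbb E\Big[\sum_{k=1}^K\sum_{i=1}^{I_k}c_k(s_k^i,a_k^i)\Big]-\min_{\pi\text{ proper}}\sum_{k=1}^KJ_k^\pi(s_0),$$ where $(s_k^i,a_k^i)$ is the $i$-th pair visited in episode $k$ and $I_k$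 is the number of steps of that episode. **Theorem.** There is a universal constant $C>0$ such that the following holds. Let $S\ge 4$ and $K$ be integers and let $D\ge 1$, $T_\star\ge D+1$ be real numbers with $S\,T_\star\le 16\,D\,K$ (which holds for example if $K\ge S\,T_\star$). Then there is an MDP with $S$ states that has a proper policy and has diameter $D+2$, such that for every learner under bandit feedback there are cost functions $c_1,\dots,c_K$ with values in $[0,1]$, fixed in advance, for which every optimal policy (every minimizer of $\sum_{k=1}^K J_k^{\pi}(s_0)$ over the proper deterministic policies) has expected hitting time $T_\star+1$ from $s_0$, and the expected regret of the learner satisfies $$\mathbb E[R_K]\ \ge\ C\sqrt{D\,T_\star\,S\,A\,K},$$ where $A$ is the average number of actions of that MDP. -/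

import Mathlib

open scoped NNReal ENNReal

namespace SSP

/-- A Markov decision process with finite state space `S`, set `A s` of actions available at the
state `s`, initial state `init` and transition function `P`. The goal state, which is not an
element of `S`, is `none : Option S`. -/
structure MDP (S : Type) (A : S → Type) where
  init : S
  P : (s : S) → A s → PMF (Option S)

/-- The set `Γ` of valid state-action pairs. -/
abbrev Pair {S : Type} (A : S → Type) : Type := Σ s, A s

/-- Deterministic stationary policies. -/
abbrev Policy {S : Type} (A : S → Type) : Type := ∀ s, A s

/-- A sequence of `K` cost functions; the values are required to be at most one by `IsCost`. -/
abbrev Costs {S : Type} (A : S → Type) (K : ℕ) : Type := Fin K → Pair A → ℝ≥0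

/-- All costs lie in `[0, 1]`. -/
def IsCost {S : Type} {A : S → Type} {K : ℕ} (c : Costs A K) : Prop := ∀ k x, c k x ≤ 1

/-- The average number `A` of available actions per state. -/
noncomputable def avgActions {S : Type} (A : S → Type) [Fintype S] [∀ s, Fintype (A s)] : ℝ :=
  (∑ s, (Fintype.card (A s) : ℝ)) / (Fintype.card S : ℝ)

namespace MDP

variable {S : Type} {A : S → Type}

/-- One step of the Markov chain that a deterministic policy induces; the goal is absorbing. -/
noncomputable def policyStep (M : MDP S A) (π : Policy A) : Option S → PMF (Option S)
  | none => PMF.pure none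
  | some s => M.P s (π s)

/-- The law of the state after `n` steps when executing `π` from the state `s`. -/
noncomputable def policyLaw (M : MDP S A) (π : Policy A) (s : S) : ℕ → PMF (Option S)
  | 0 => PMF.pure (some s)
  | n + 1 => (M.policyLaw π s n).bind (M.policyStep π)

/-- `π` is proper: from every state the goal is reached within finitely many steps with
probability one (the events "the goal has been reached after `n` steps" increase with `n`). -/
def IsProper (M : MDP S A) (π : Policy A) : Prop :=
  ∀ s, ⨆ n, M.policyLaw π s n none = 1

/-- The expected number of steps to reach the goal from `s`, as the sum over `n` of the
probability that step `n + 1` is taken, i.e. that the goal has not been reached after `n` steps. -/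
noncomputable def hittingTime [Fintype S] (M : MDP S A) (π : Policy A) (s : S) : ℝ≥0∞ :=
  ∑' n, ∑ t, M.policyLaw π s n (some t)

/-- The cost-to-go `J^π(s)`: the expected total cost of `π` from `s` until the goal is reached. -/
noncomputable def costToGo [Fintype S] (M : MDP S A) (c : Pair A → ℝ≥0) (π : Policy A) (s : S) :
    ℝ≥0∞ :=
  ∑' n, ∑ t, M.policyLaw π s n (some t) * (c ⟨t, π t⟩ : ℝ≥0∞)

/-- The diameter `max_s min_π T^π(s)`, with `π` ranging over the proper policies. -/
noncomputable def diameter [Fintype S] (M : MDP S A) : ℝ≥0∞ :=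
  ⨆ s, ⨅ π, ⨅ _ : M.IsProper π, M.hittingTime π s

/-- The total expected cost of `π` from the initial state over the `K` episodes. -/
noncomputable def totalCostToGo [Fintype S] {K : ℕ} (M : MDP S A) (c : Costs A K) (π : Policy A) :
    ℝ≥0∞ :=
  ∑ k, M.costToGo (c k) π M.init

/-- `π` is a best deterministic proper policy in hindsight. -/
def IsOptimal [Fintype S] {K : ℕ} (M : MDP S A) (c : Costs A K) (π : Policy A) : Prop :=
  M.IsProper π ∧ ∀ π', M.IsProper π' → M.totalCostToGo c π ≤ M.totalCostToGo c π'

end MDP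

/-- A (randomized) learner under bandit feedback. It chooses a distribution of the next action from
* `past`: for every completed episode the list of visited state-action pairs with their costs,
* `cur`: the list of state-action pairs visited so far in the current episode, whose costs are
  revealed only when the goal has been reached,
* the current state. -/
abbrev Learner {S : Type} (A : S → Type) : Type :=
  (past : List (List (Pair A × ℝ≥0))) → (cur : List (Pair A)) → (s : S) → PMF (A s)

/-- The situation of the learner before a step: observations from completed episodes,
state-action pairs of the current episode, current state. -/
structure Config {S : Type} (A : S → Type) where
  past : List (List (Pair A × ℝ≥0))
  cur : List (Pair A)
  state : S

section Interaction

variable {S : Type} {A : S → Type} {K : ℕ}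

/-- The configuration after taking action `a` in episode `k` and moving to the given state. At the
goal the costs of the visited pairs are revealed and the next episode starts. -/
def nextConfig (M : MDP S A) (c : Costs A K) (x : Config A) (k : Fin K) (a : A x.state) :
    Option S → Config A
  | some t => ⟨x.past, x.cur ++ [⟨x.state, a⟩], t⟩
  | none => ⟨x.past ++ [(x.cur ++ [(⟨x.state, a⟩ : Pair A)]).map fun y => (y, c k y)], [], M.init⟩

/-- One step of the interaction; it stops after `K` completed episodes. -/
noncomputable def interactionStep (M : MDP S A) (c : Costs A K) (L : Learner A) (x : Config A) :
    PMF (Config A) :=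
  if h : x.past.length < K then
    (L x.past x.cur x.state).bind fun a =>
      (M.P x.state a).map (nextConfig M c x ⟨x.past.length, h⟩ a)
  else PMF.pure x

/-- The law of the configuration after `n` steps, counted over all episodes. -/
noncomputable def interactionLaw (M : MDP S A) (c : Costs A K) (L : Learner A) :
    ℕ → PMF (Config A)
  | 0 => PMF.pure ⟨[], [], M.init⟩
  | n + 1 => (interactionLaw M c L n).bind (interactionStep M c L)

/-- The conditional expectation of the cost of the next step given the configuration. -/
noncomputable def stepCost [∀ s, Fintype (A s)] (c : Costs A K) (L : Learner A) (x : Config A) :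
    ℝ≥0∞ :=
  if h : x.past.length < K then
    ∑ a, L x.past x.cur x.state a * (c ⟨x.past.length, h⟩ ⟨x.state, a⟩ : ℝ≥0∞)
  else 0

/-- The expected total cost of the learner over the `K` episodes, summed step by step. -/
noncomputable def learnerCost [∀ s, Fintype (A s)] (M : MDP S A) (c : Costs A K) (L : Learner A) :
    ℝ≥0∞ :=
  ∑' n, ∑' x, interactionLaw M c L n x * stepCost c L x

/-- The expected regret: expected total cost of the learner minus the total expected cost of the
best deterministic proper policy in hindsight (finite as soon as a proper policy exists). -/
noncomputable def expectedRegret [Fintype S] [∀ s, Fintype (A s)] (M : MDP S A) (c : Costs A K)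
    (L : Learner A) : EReal :=
  (learnerCost M c L : EReal) -
    ((⨅ π, ⨅ _ : M.IsProper π, M.totalCostToGo c π : ℝ≥0∞) : EReal)

end Interaction

end SSP

set_option linter.unusedSectionVars false

/-! The instance is a stochastic bandit problem with `N + 1` arms, where `S = N + 3`. An arm is
chosen in the initial state. Staying in it takes `T` steps on average, and the only alternative is
to leave through a fast state whose exit takes `D` steps on average. The cost of staying is fixed
within an episode and revealed at its end, and arms cannot be switched, so an episode shows at most
one informative bit although that bit is paid about `T` times.

Arm `0` always costs `p = D / (4T)`. In instance `J ≠ 0` the bit of arm `J` has mean `p - e` and all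
other bits have mean `p + e`; in instance `0` all bits have mean `p + e`. Staying costs at most
`3D/8` on average, less than the `D + 1` for leaving, so leaving never helps and each episode that
does not choose `J` loses at least `e * T` (`cost_lower_bound`). As the bits have variance of order
`p`, a gap `e` of order `√(p N / K)` stays undetected. The regret is then of order `e T K`, that is
`√(D T N K)`, and `S A = 3N + 4`.

Instance `J` differs from instance `0` in one coordinate only. The number of choices of `J` under
instance `J` is the mean under instance `0` of the choices weighted by the likelihood ratio `Z` of
the past (`meanValue_choose_eq`). The bound `Z ≤ 5/3 + 4/3 φ(Z)`, with `φ` the triangular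
discrimination, reduces this to the growth of `φ(Z)`, which is at most four times the chi-square
divergence per episode that reveals the bit (`discrimination_step`), uniformly in `Z`. Hence the
count grows at most by a constant factor (`meanValue_choose_le`). Summed over `J`, the counts are at
most `11/12 (N + 1) K`, so on average over `J` at least `e T K / 12` is lost, and some fixed `J` and
fixed bits do as badly up to the constant (`exists_large_regret`).

All expectations are backward recursions over a finite horizon `n`, bounded by potential functions
checked one step at a time. Since a learner need not finish soon, lower bounds carry an error of
order `1 / n`, removed by taking `n` large. -/

namespace SSP

/-! ### Finite product measures. -/

section ProductWeights

variable {ι ρ : Type} [Fintype ι] [DecidableEq ι] [Fintype ρ]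

/-- Replacing the `i`-th factor of a product weight amounts to resampling the `i`-th coordinate. -/
theorem sum_prod_mul_eq_sum_update (w w' : ι → ρ → ℝ) (i : ι) (hw : ∑ r, w i r = 1)
    (hw' : ∀ k, k ≠ i → w' k = w k) (F : (ι → ρ) → ℝ) :
    ∑ b : ι → ρ, (∏ k, w' k (b k)) * F b =
      ∑ b : ι → ρ, (∏ k, w k (b k)) * ∑ r, w' i r * F (Function.update b i r) := by
  have key : ∀ (v : ι → ρ → ℝ) (G : (ι → ρ) → ℝ), (∀ k, k ≠ i → v k = w k) →
      ∑ b : ι → ρ, (∏ k, v k (b k)) * G b =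
        ∑ y : {k // k ≠ i} → ρ, (∏ k : {k // k ≠ i}, w k (y k)) *
          ∑ r, v i r * G ((Equiv.funSplitAt i ρ).symm (r, y)) := by
    intro v G hv
    rw [← (Equiv.funSplitAt i ρ).symm.sum_comp, Fintype.sum_prod_type_right]
    refine Finset.sum_congr rfl fun y _ => ?_
    rw [Finset.mul_sum]
    refine Finset.sum_congr rfl fun r _ => ?_
    have h : ∏ k, v k ((Equiv.funSplitAt i ρ).symm (r, y) k) =
        v i r * ∏ k : {k // k ≠ i}, w k (y k) := by
      rw [Fintype.prod_eq_mul_prod_subtype_ne _ i]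
      congr 1
      · simp [Equiv.funSplitAt, Equiv.piSplitAt]
      · refine Finset.prod_congr rfl fun k _ => ?_
        rw [hv k k.2]
        simp [Equiv.funSplitAt, Equiv.piSplitAt, k.2]
    rw [h]
    ring
  rw [key w' F hw', key w _ fun _ _ => rfl]
  refine Finset.sum_congr rfl fun y _ => ?_
  congr 1
  have hu : ∀ r r', Function.update ((Equiv.funSplitAt i ρ).symm (r, y)) i r' =
      (Equiv.funSplitAt i ρ).symm (r', y) := by
    intro r r'
    ext k
    by_cases hk : k = i
    · subst hk
      simp [Equiv.funSplitAt, Equiv.piSplitAt]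
    · simp [Equiv.funSplitAt, Equiv.piSplitAt, hk]
  simp only [hu, ← Finset.sum_mul, hw, one_mul]

theorem sum_prod_eq_one (w : ι → ρ → ℝ) (hw : ∀ i, ∑ r, w i r = 1) :
    ∑ b : ι → ρ, ∏ k, w k (b k) = 1 := by
  rw [← Fintype.prod_sum]
  simp [hw]

theorem sum_prod_mul_coord (w : ι → ρ → ℝ) (hw : ∀ i, ∑ r, w i r = 1) (i : ι) (φ : ρ → ℝ) :
    ∑ b : ι → ρ, (∏ k, w k (b k)) * φ (b i) = ∑ r, w i r * φ r := by
  rw [sum_prod_mul_eq_sum_update w w i (hw i) (fun _ _ => rfl)]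
  simp only [Function.update_self, ← Finset.sum_mul, sum_prod_eq_one w hw, one_mul]

end ProductWeights

/-! ### Finite-horizon values of a learner, and potential functions. -/

section Values

variable {S : Type} {A : S → Type} [Fintype S] [∀ s, Fintype (A s)] {K : ℕ} {ρ : Type} [Fintype ρ]

/-- The configuration after one step when the costs of the current episode are `d`. -/
def stepTo (M : MDP S A) (d : Pair A → ℝ≥0) (x : Config A) (a : A x.state) :
    Option S → Config A
  | some t => ⟨x.past, x.cur ++ [⟨x.state, a⟩], t⟩
  | none => ⟨x.past ++ [(x.cur ++ [(⟨x.state, a⟩ : Pair A)]).map fun y => (y, d y)], [], M.init⟩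

/-- The learner's probability of playing `a` in the configuration `x`. -/
noncomputable def playProb (L : Learner A) (x : Config A) (a : A x.state) : ℝ :=
  (L x.past x.cur x.state a).toReal

/-- The expectation of `f` over the state that follows the pair `(s, a)`. -/
noncomputable def meanNext (M : MDP S A) (s : S) (a : A s) (f : Option S → ℝ) : ℝ :=
  ∑ o, (M.P s a o).toReal * f o

/-- The expected sum of the gains `g` over the next `n` steps, starting from a configuration, when
the costs of episode `k` are `C (b k)`. -/
noncomputable def fixedValue (M : MDP S A) (L : Learner A) (C : ρ → Pair A → ℝ≥0) (b : Fin K → ρ)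
    (g : ρ → (x : Config A) → A x.state → ℝ) : ℕ → Config A → ℝ
  | 0, _ => 0
  | n + 1, x =>
    if h : x.past.length < K then
      ∑ a, playProb L x a * (g (b ⟨x.past.length, h⟩) x a +
        meanNext M x.state a fun o =>
          fixedValue M L C b g n (stepTo M (C (b ⟨x.past.length, h⟩)) x a o))
    else 0

/-- The analogue of `fixedValue` when the rows are drawn independently with weights `ν`. -/
noncomputable def meanValue (M : MDP S A) (L : Learner A) (C : ρ → Pair A → ℝ≥0) (K : ℕ)
    (ν : ρ → ℝ) (g : ρ → (x : Config A) → A x.state → ℝ) : ℕ → Config A → ℝ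
  | 0, _ => 0
  | n + 1, x =>
    if x.past.length < K then
      ∑ r, ν r * ∑ a, playProb L x a * (g r x a +
        meanNext M x.state a fun o => meanValue M L C K ν g n (stepTo M (C r) x a o))
    else 0

theorem sum_toReal_eq_one {α : Type} [Fintype α] (p : PMF α) : ∑ a, (p a).toReal = 1 := by
  rw [← ENNReal.toReal_sum fun a _ => p.apply_ne_top a, ← tsum_fintype (L := .unconditional α), p.tsum_coe,
    ENNReal.toReal_one]

theorem playProb_nonneg (L : Learner A) (x : Config A) (a : A x.state) : 0 ≤ playProb L x a :=
  ENNReal.toReal_nonneg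

theorem sum_playProb (L : Learner A) (x : Config A) : ∑ a, playProb L x a = 1 :=
  sum_toReal_eq_one _

variable (M : MDP S A) (L : Learner A) (C : ρ → Pair A → ℝ≥0)

theorem meanNext_mono {s : S} (a : A s) {f f' : Option S → ℝ} (h : ∀ o, f o ≤ f' o) :
    meanNext M s a f ≤ meanNext M s a f' :=
  Finset.sum_le_sum fun o _ => mul_le_mul_of_nonneg_left (h o) ENNReal.toReal_nonneg

theorem meanNext_const {s : S} (a : A s) (z : ℝ) : meanNext M s a (fun _ => z) = z := by
  rw [meanNext, ← Finset.sum_mul, sum_toReal_eq_one, one_mul]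

theorem meanNext_add {s : S} (a : A s) (f f' : Option S → ℝ) :
    meanNext M s a (fun o => f o + f' o) = meanNext M s a f + meanNext M s a f' := by
  simp only [meanNext, mul_add, Finset.sum_add_distrib]

theorem meanNext_mul {s : S} (a : A s) (z : ℝ) (f : Option S → ℝ) :
    meanNext M s a (fun o => z * f o) = z * meanNext M s a f := by
  simp only [meanNext, Finset.mul_sum]
  exact Finset.sum_congr rfl fun o _ => by ring

theorem length_past_le_stepTo (d : Pair A → ℝ≥0) (x : Config A) (a : A x.state) (o : Option S) :
    x.past.length ≤ (stepTo M d x a o).past.length := by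
  cases o <;> simp [stepTo]

/-- The rows of completed episodes are never read again. This allows resampling the row of an
episode as soon as it is over. -/
theorem fixedValue_congr (g : ρ → (x : Config A) → A x.state → ℝ) (n : ℕ) :
    ∀ (x : Config A) (b b' : Fin K → ρ), (∀ k : Fin K, x.past.length ≤ k → b k = b' k) →
      fixedValue M L C b g n x = fixedValue M L C b' g n x := by
  induction n with
  | zero => intros; rfl
  | succ n ih =>
    intro x b b' h
    simp only [fixedValue]
    split_ifs with hx
    · rw [h ⟨_, hx⟩ le_rfl]
      refine Finset.sum_congr rfl fun a _ => ?_
      congr 2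
      congr 1
      funext o
      exact ih _ _ _ fun k hk => h k ((length_past_le_stepTo M _ x a o).trans hk)
    · rfl

theorem sum_step_exchange {β α ω : Type} [Fintype β] [Fintype α] [Fintype ω] (w : β → ℝ) (ν : ρ → ℝ)
    (p : α → ℝ) (g : ρ → α → ℝ) (q : α → ω → ℝ) (X : β → ρ → α → ω → ℝ) (hw : ∑ b, w b = 1) :
    ∑ b, w b * ∑ r, ν r * ∑ a, p a * (g r a + ∑ o, q a o * X b r a o) =
      ∑ a, p a * (∑ r, ν r * g r a + ∑ o, q a o * ∑ b, w b * ∑ r, ν r * X b r a o) := by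
  have h1 : ∀ b, ∑ r, ν r * ∑ a, p a * (g r a + ∑ o, q a o * X b r a o) =
      ∑ a, p a * (∑ r, ν r * g r a) + ∑ a, p a * ∑ o, q a o * ∑ r, ν r * X b r a o := by
    intro b
    simp only [mul_add, Finset.mul_sum, Finset.sum_add_distrib]
    congr 1
    · rw [Finset.sum_comm]
      exact Finset.sum_congr rfl fun _ _ => Finset.sum_congr rfl fun _ _ => by ring
    · rw [Finset.sum_comm]
      refine Finset.sum_congr rfl fun _ _ => ?_
      rw [Finset.sum_comm]
      exact Finset.sum_congr rfl fun _ _ => Finset.sum_congr rfl fun _ _ => by ring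
  simp only [h1]
  simp only [mul_add, Finset.sum_add_distrib, ← Finset.sum_mul, hw, one_mul]
  congr 1
  simp only [Finset.mul_sum]
  rw [Finset.sum_comm]
  refine Finset.sum_congr rfl fun _ _ => ?_
  rw [Finset.sum_comm]
  refine Finset.sum_congr rfl fun _ _ => Finset.sum_congr rfl fun _ _ =>
    Finset.sum_congr rfl fun _ _ => by ring

/-- `meanValue` draws a fresh row at every step, not once per episode, and still gives the right
average. Under bandit feedback the row does not influence the configuration before the goal is
reached, so inside an episode it can be redrawn; at the goal it is recorded, and it has no further
influence afterwards. Gains enter linearly, so only their conditional means matter. -/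
theorem sum_fixedValue (ν : ρ → ℝ) (hν : ∑ r, ν r = 1)
    (g : ρ → (x : Config A) → A x.state → ℝ) (n : ℕ) :
    ∀ x : Config A, ∑ b : Fin K → ρ, (∏ k, ν (b k)) * fixedValue M L C b g n x =
      meanValue M L C K ν g n x := by
  induction n with
  | zero => simp [fixedValue, meanValue]
  | succ n ih =>
    intro x
    by_cases hx : x.past.length < K
    · rw [sum_prod_mul_eq_sum_update (fun _ => ν) (fun _ => ν) ⟨_, hx⟩ hν (fun _ _ => rfl)]
      simp only [fixedValue, meanValue, hx, dif_pos, if_true, Function.update_self, meanNext]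
      rw [sum_step_exchange _ _ _ _ _ _ (sum_prod_eq_one _ fun _ => hν)]
      have h1 := sum_step_exchange (fun _ : Unit => 1) ν (playProb L x) (fun r a => g r x a)
        (fun a o => (M.P x.state a o).toReal)
        (fun _ r a o => meanValue M L C K ν g n (stepTo M (C r) x a o)) (by simp)
      simp only [Finset.univ_unique, Finset.sum_singleton, one_mul] at h1
      rw [h1]
      refine Finset.sum_congr rfl fun a _ => ?_
      congr 2
      refine Finset.sum_congr rfl fun o _ => ?_
      congr 1
      cases o with
      | some t =>
        have h2 := sum_prod_mul_eq_sum_update (fun _ : Fin K => ν) (fun _ => ν) ⟨_, hx⟩ hν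
          (fun _ _ => rfl) fun b => fixedValue M L C b g n ⟨x.past, x.cur ++ [⟨x.state, a⟩], t⟩
        rw [ih] at h2
        simp only [stepTo]
        rw [← h2, ← Finset.sum_mul, hν, one_mul]
      | none =>
        simp only [Finset.mul_sum]
        rw [Finset.sum_comm]
        refine Finset.sum_congr rfl fun r _ => ?_
        rw [← ih, Finset.mul_sum]
        refine Finset.sum_congr rfl fun b _ => ?_
        rw [fixedValue_congr M L C g n _ (Function.update b ⟨_, hx⟩ r) b]
        · ring
        · intro k hk
          rw [Function.update_of_ne]
          rintro rfl
          simp [stepTo] at hk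
    · simp [fixedValue, meanValue, hx]

variable {M L C} {ν : ρ → ℝ} {g : ρ → (x : Config A) → A x.state → ℝ}

/-- The expected gain of a step with action `a` plus the expected value of `V` afterwards. -/
noncomputable def bellman (M : MDP S A) (C : ρ → Pair A → ℝ≥0) (ν : ρ → ℝ)
    (g : ρ → (x : Config A) → A x.state → ℝ) (V : Config A → ℝ) (x : Config A) (a : A x.state) :
    ℝ :=
  ∑ r, ν r * (g r x a + meanNext M x.state a fun o => V (stepTo M (C r) x a o))

theorem meanValue_succ (n : ℕ) {x : Config A} (hx : x.past.length < K) :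
    meanValue M L C K ν g (n + 1) x =
      ∑ a, playProb L x a * bellman M C ν g (meanValue M L C K ν g n) x a := by
  simp only [meanValue, hx, if_true, bellman, Finset.mul_sum]
  rw [Finset.sum_comm]
  exact Finset.sum_congr rfl fun _ _ => Finset.sum_congr rfl fun _ _ => by ring

theorem meanValue_of_le (n : ℕ) {x : Config A} (hx : K ≤ x.past.length) :
    meanValue M L C K ν g n x = 0 := by
  cases n <;> simp [meanValue, hx.not_gt]

theorem sum_playProb_mul_le {x : Config A} {f : A x.state → ℝ} {z : ℝ} (h : ∀ a, f a ≤ z) :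
    ∑ a, playProb L x a * f a ≤ z := by
  calc ∑ a, playProb L x a * f a ≤ ∑ a, playProb L x a * z :=
        Finset.sum_le_sum fun a _ => mul_le_mul_of_nonneg_left (h a) (playProb_nonneg L x a)
    _ = z := by rw [← Finset.sum_mul, sum_playProb, one_mul]

theorem bellman_mono (hν : ∀ r, 0 ≤ ν r) {V V' : Config A → ℝ} (h : ∀ x, V x ≤ V' x)
    (x : Config A) (a : A x.state) : bellman M C ν g V x a ≤ bellman M C ν g V' x a :=
  Finset.sum_le_sum fun r _ => mul_le_mul_of_nonneg_left
    (add_le_add_right (meanNext_mono M a fun _ => h _) _) (hν r)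

/-- A nonnegative potential that pays for the gains bounds the expected total gain. -/
theorem meanValue_le_potential (hν : ∀ r, 0 ≤ ν r) {V : Config A → ℝ} (hV : ∀ x, 0 ≤ V x)
    (h : ∀ x : Config A, x.past.length < K → ∀ a, bellman M C ν g V x a ≤ V x) (n : ℕ) :
    ∀ x, meanValue M L C K ν g n x ≤ V x := by
  induction n with
  | zero => exact hV
  | succ n ih =>
    intro x
    by_cases hx : x.past.length < K
    · rw [meanValue_succ n hx]
      exact sum_playProb_mul_le fun a => (bellman_mono hν ih x a).trans (h x hx a)
    · rw [meanValue_of_le _ (not_lt.mp hx)]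
      exact hV x

theorem meanValue_nonneg (hν : ∀ r, 0 ≤ ν r) (hg : ∀ r x a, 0 ≤ g r x a) (n : ℕ) :
    ∀ x, 0 ≤ meanValue M L C K ν g n x := by
  induction n with
  | zero => exact fun _ => le_rfl
  | succ n ih =>
    intro x
    by_cases hx : x.past.length < K
    · rw [meanValue_succ n hx]
      refine Finset.sum_nonneg fun a _ => mul_nonneg (playProb_nonneg L x a)
        (Finset.sum_nonneg fun r _ => mul_nonneg (hν r) (add_nonneg (hg r x a) ?_))
      rw [← meanNext_const M a 0]
      exact meanNext_mono M a fun o => ih _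
    · rw [meanValue_of_le _ (not_lt.mp hx)]

theorem bellman_add {g' : ρ → (x : Config A) → A x.state → ℝ} (V V' : Config A → ℝ) (x : Config A)
    (a : A x.state) :
    bellman M C ν (fun r x a => g r x a + g' r x a) (fun x => V x + V' x) x a =
      bellman M C ν g V x a + bellman M C ν g' V' x a := by
  simp only [bellman, meanNext_add, ← Finset.sum_add_distrib]
  exact Finset.sum_congr rfl fun _ _ => by ring

theorem bellman_mul (z : ℝ) (V : Config A → ℝ) (x : Config A) (a : A x.state) :
    bellman M C ν (fun r x a => z * g r x a) (fun x => z * V x) x a =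
      z * bellman M C ν g V x a := by
  simp only [bellman, meanNext_mul, Finset.mul_sum]
  exact Finset.sum_congr rfl fun _ _ => by ring

theorem meanValue_add {g' : ρ → (x : Config A) → A x.state → ℝ} (n : ℕ) :
    ∀ x, meanValue M L C K ν (fun r x a => g r x a + g' r x a) n x =
      meanValue M L C K ν g n x + meanValue M L C K ν g' n x := by
  induction n with
  | zero => simp [meanValue]
  | succ n ih =>
    intro x
    by_cases hx : x.past.length < K
    · rw [meanValue_succ n hx, meanValue_succ n hx, meanValue_succ n hx, funext ih,
        ← Finset.sum_add_distrib]
      simp only [bellman_add, mul_add]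
    · simp [meanValue_of_le _ (not_lt.mp hx)]

theorem meanValue_mul (z : ℝ) (n : ℕ) :
    ∀ x, meanValue M L C K ν (fun r x a => z * g r x a) n x =
      z * meanValue M L C K ν g n x := by
  induction n with
  | zero => simp [meanValue]
  | succ n ih =>
    intro x
    by_cases hx : x.past.length < K
    · rw [meanValue_succ n hx, meanValue_succ n hx, funext ih]
      simp only [bellman_mul, Finset.mul_sum, mul_left_comm]
    · simp [meanValue_of_le _ (not_lt.mp hx)]

theorem meanValue_sum {ι : Type} (t : Finset ι) (f : ι → ρ → (x : Config A) → A x.state → ℝ)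
    (n : ℕ) (x : Config A) :
    meanValue M L C K ν (fun r x a => ∑ i ∈ t, f i r x a) n x =
      ∑ i ∈ t, meanValue M L C K ν (f i) n x := by
  induction t using Finset.cons_induction with
  | empty =>
    simpa using meanValue_mul (M := M) (L := L) (C := C) (K := K) (ν := ν)
      (g := fun _ _ _ => 0) 0 n x
  | cons i t hi ih => simp only [Finset.sum_cons, meanValue_add, ih]

/-- A bounded potential that the gains pay for is a lower bound of the expected total gain, up to
an error that is controlled by a bound `H` on the expected number of steps. -/
theorem potential_le_meanValue (hν : ∀ r, 0 ≤ ν r) (hν1 : ∑ r, ν r = 1)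
    (hg : ∀ r x a, 0 ≤ g r x a) {V H : Config A → ℝ} {B : ℝ} (hB : 0 ≤ B)
    (hV : ∀ x : Config A, K ≤ x.past.length → V x = 0) (hVB : ∀ x, V x ≤ B)
    (h : ∀ x : Config A, x.past.length < K → ∀ a, V x ≤ bellman M C ν g V x a)
    (hH0 : ∀ x, 0 ≤ H x)
    (hH : ∀ x : Config A, x.past.length < K → ∀ a, bellman M C ν (fun _ _ _ => 1) H x a ≤ H x)
    (n : ℕ) : ∀ x, n * V x ≤ n * meanValue M L C K ν g n x + B * H x := by
  have hone : ∀ (x : Config A) (a : A x.state) (z z' : ℝ),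
      bellman M C ν (fun _ _ _ => z) (fun _ => z') x a = z + z' := by
    intro x a z z'
    simp only [bellman, meanNext_const, ← Finset.sum_mul, hν1, one_mul]
  induction n with
  | zero => intro x; simpa [meanValue] using mul_nonneg hB (hH0 x)
  | succ n ih =>
    intro x
    by_cases hx : x.past.length < K
    · rw [meanValue_succ n hx]
      push_cast
      have hmean0 := meanValue_nonneg (M := M) (L := L) (C := C) (K := K) hν hg n
      set W := meanValue M L C K ν g n
      -- Of the `n + 1` copies of `V`, the induction hypothesis handles `n`, with error `B` times
      -- the mean of `H` after the step, which is at most `B * (H x - 1)`. The remaining copy uses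
      -- the crude bound `V ≤ W + B`; its error `B` is exactly the unit by which `H` drops in a
      -- step.
      have key : ∀ a, ((n : ℝ) + 1) * V x - B * H x ≤ (n + 1) * bellman M C ν g W x a := by
        intro a
        have h1 := h x hx a
        have h2 : bellman M C ν (fun r x a => n * g r x a) (fun x => n * V x) x a ≤
            bellman M C ν (fun r x a => n * g r x a + B * 0) (fun x => n * W x + B * H x) x a := by
          simp only [mul_zero, add_zero]
          exact bellman_mono hν ih x a
        have h3 : bellman M C ν (fun r x a => n * g r x a + B * 0)
            (fun x => n * W x + B * H x) x a = n * bellman M C ν g W x a +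
              B * bellman M C ν (fun _ _ _ => 0) H x a := by
          rw [bellman_add (fun x => n * W x) (fun x => B * H x), bellman_mul, bellman_mul]
        have h4 : bellman M C ν (fun _ _ _ => 1) H x a =
            1 + bellman M C ν (fun _ _ _ => 0) H x a := by
          have := bellman_add (M := M) (C := C) (ν := ν) (g := fun _ _ _ => 1)
            (g' := fun _ _ _ => 0) (fun _ => 0) H x a
          simpa [hone] using this
        have h5 : bellman M C ν g V x a ≤ bellman M C ν g W x a + B := by
          have h6 : bellman M C ν g V x a ≤ bellman M C ν g (fun x => W x + B) x a :=
            bellman_mono hν (fun y => (hVB y).trans (le_add_of_nonneg_left (hmean0 y))) x a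
          have h7 := bellman_add (M := M) (C := C) (ν := ν) (g := g)
            (g' := fun _ _ _ => 0) W (fun _ => B) x a
          simp only [add_zero, hone, zero_add] at h7
          rwa [h7] at h6
        rw [bellman_mul, h3] at h2
        have h8 := mul_le_mul_of_nonneg_left (hH x hx a) hB
        rw [h4] at h8
        have h9 : (n : ℝ) * V x ≤ n * bellman M C ν g V x a :=
          mul_le_mul_of_nonneg_left h1 n.cast_nonneg
        nlinarith
      have hsum : ((n : ℝ) + 1) * V x - B * H x ≤
          ∑ a, playProb L x a * ((n + 1) * bellman M C ν g W x a) := by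
        calc ((n : ℝ) + 1) * V x - B * H x
            = ∑ a, playProb L x a * (((n : ℝ) + 1) * V x - B * H x) := by
              rw [← Finset.sum_mul, sum_playProb, one_mul]
          _ ≤ _ := Finset.sum_le_sum fun a _ =>
              mul_le_mul_of_nonneg_left (key a) (playProb_nonneg L x a)
      rw [Finset.mul_sum]
      simp only [mul_left_comm ((n : ℝ) + 1)]
      linarith
    · rw [hV x (not_lt.mp hx), meanValue_of_le _ (not_lt.mp hx)]
      simpa using mul_nonneg hB (hH0 x)

/-- Change of measure: `Z` is the likelihood ratio of the weights `ν'` with respect to `ν` that is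
revealed by the past. -/
theorem mul_meanValue_eq {ν' : ρ → ℝ} {Z : Config A → ℝ} {γ : (x : Config A) → A x.state → ℝ}
    (hν : ∑ r, ν r = 1) (hν' : ∑ r, ν' r = 1)
    (hZ : ∀ (x : Config A) a o (F : Config A → ℝ),
      ∑ r, ν' r * (Z x * F (stepTo M (C r) x a o)) =
        ∑ r, ν r * (Z (stepTo M (C r) x a o) * F (stepTo M (C r) x a o))) (n : ℕ) :
    ∀ x, Z x * meanValue M L C K ν' (fun _ x a => γ x a) n x =
      meanValue M L C K ν (fun _ x a => Z x * γ x a) n x := by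
  induction n with
  | zero => simp [meanValue]
  | succ n ih =>
    intro x
    by_cases hx : x.past.length < K
    · rw [meanValue_succ n hx, meanValue_succ n hx, Finset.mul_sum]
      refine Finset.sum_congr rfl fun a _ => ?_
      rw [mul_left_comm]
      congr 1
      simp only [bellman, mul_add, Finset.sum_add_distrib, ← Finset.sum_mul, hν, hν', one_mul]
      congr 1
      simp only [meanNext, Finset.mul_sum, ← funext ih]
      rw [Finset.sum_comm, Finset.sum_comm (s := Finset.univ (α := ρ))]
      refine Finset.sum_congr rfl fun o _ => ?_
      have h := congrArg ((M.P x.state a o).toReal * ·)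
        (hZ x a o (meanValue M L C K ν' (fun _ x a => γ x a) n))
      simp only [Finset.mul_sum] at h
      convert h using 1 <;> exact Finset.sum_congr rfl fun r _ => by ring
    · simp [meanValue_of_le _ (not_lt.mp hx)]

end Values

/-! ### From backward values to the law of the interaction. -/

section Laws

theorem tsum_bind_mul {α β : Type} (p : PMF α) (q : α → PMF β) (f : β → ℝ≥0∞) :
    ∑' y, p.bind q y * f y = ∑' x, p x * ∑' y, q x y * f y := by
  simp only [PMF.bind_apply, ← ENNReal.tsum_mul_right, ← ENNReal.tsum_mul_left]
  rw [ENNReal.tsum_comm]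
  simp only [mul_assoc]

theorem tsum_pure_mul {α : Type} (x : α) (f : α → ℝ≥0∞) : ∑' y, PMF.pure x y * f y = f x := by
  rw [tsum_eq_single x]
  · simp
  · intro y hy
    simp [PMF.pure_apply, hy]

theorem tsum_map_mul {α β : Type} (p : PMF α) (h : α → β) (f : β → ℝ≥0∞) :
    ∑' y, p.map h y * f y = ∑' x, p x * f (h x) := by
  rw [← PMF.bind_pure_comp, tsum_bind_mul]
  simp only [Function.comp_apply, tsum_pure_mul]

variable {S : Type} {A : S → Type} [Fintype S] [∀ s, Fintype (A s)] {K : ℕ} {ρ : Type} [Fintype ρ]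
  (M : MDP S A) (L : Learner A) (C : ρ → Pair A → ℝ≥0) (b : Fin K → ρ)

/-- The cost of the chosen pair as a gain. -/
def costGain (C : ρ → Pair A → ℝ≥0) (r : ρ) (x : Config A) (a : A x.state) : ℝ :=
  C r ⟨x.state, a⟩

theorem fixedValue_nonneg {g : ρ → (x : Config A) → A x.state → ℝ} (hg : ∀ r x a, 0 ≤ g r x a)
    (n : ℕ) : ∀ x, 0 ≤ fixedValue M L C b g n x := by
  induction n with
  | zero => exact fun _ => le_rfl
  | succ n ih =>
    intro x
    rw [fixedValue]
    split_ifs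
    · refine Finset.sum_nonneg fun a _ => mul_nonneg (playProb_nonneg L x a) (add_nonneg
        (hg _ _ _) (Finset.sum_nonneg fun o _ => mul_nonneg ENNReal.toReal_nonneg (ih _)))
    · exact le_rfl

theorem costGain_nonneg (r : ρ) (x : Config A) (a : A x.state) : 0 ≤ costGain C r x a :=
  NNReal.coe_nonneg _

theorem ofReal_fixedValue_succ (n : ℕ) (x : Config A) :
    ENNReal.ofReal (fixedValue M L C b (costGain C) (n + 1) x) =
      stepCost (fun k => C (b k)) L x + ∑' y, interactionStep M (fun k => C (b k)) L x y *
        ENNReal.ofReal (fixedValue M L C b (costGain C) n y) := by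
  have h0 := fixedValue_nonneg M L C b (costGain_nonneg C) n
  by_cases hx : x.past.length < K
  · simp only [fixedValue, hx, dif_pos, stepCost, interactionStep, meanNext]
    rw [tsum_bind_mul, tsum_fintype, ← Finset.sum_add_distrib, ENNReal.ofReal_sum_of_nonneg]
    · refine Finset.sum_congr rfl fun a _ => ?_
      rw [tsum_map_mul, ← mul_add, ENNReal.ofReal_mul (playProb_nonneg L x a), playProb,
        ENNReal.ofReal_toReal (PMF.apply_ne_top _ _), tsum_fintype]
      congr 1
      rw [ENNReal.ofReal_add (costGain_nonneg C _ _ _)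
        (Finset.sum_nonneg fun o _ => mul_nonneg ENNReal.toReal_nonneg (h0 _))]
      congr 1
      · simp [costGain]
      · rw [ENNReal.ofReal_sum_of_nonneg
          fun o _ => mul_nonneg ENNReal.toReal_nonneg (h0 _)]
        refine Finset.sum_congr rfl fun o _ => ?_
        rw [ENNReal.ofReal_mul ENNReal.toReal_nonneg, ENNReal.ofReal_toReal (PMF.apply_ne_top _ _)]
        cases o <;> rfl
    · exact fun a _ => mul_nonneg (playProb_nonneg L x a) (add_nonneg (costGain_nonneg C _ _ _)
        (Finset.sum_nonneg fun o _ => mul_nonneg ENNReal.toReal_nonneg (h0 _)))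
  · have hz : ∀ n, fixedValue M L C b (costGain C) n x = 0 := by
      intro n
      cases n <;> simp [fixedValue, hx]
    simp only [stepCost, interactionStep, hx, dif_neg, not_false_eq_true, tsum_pure_mul, hz]
    simp

/-- Unrolling the backward recursion from time `m` gives the forward sum of `n` step costs, which
for `m = 0` is a partial sum of `learnerCost`. -/
theorem tsum_law_mul_fixedValue (n : ℕ) : ∀ m,
    ∑' x, interactionLaw M (fun k => C (b k)) L m x *
        ENNReal.ofReal (fixedValue M L C b (costGain C) n x) =
      ∑ i ∈ Finset.range n, ∑' x, interactionLaw M (fun k => C (b k)) L (m + i) x *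
        stepCost (fun k => C (b k)) L x := by
  induction n with
  | zero => simp [fixedValue]
  | succ n ih =>
    intro m
    simp only [ofReal_fixedValue_succ, mul_add, ENNReal.tsum_add]
    rw [Finset.sum_range_succ', add_zero, add_comm, ← tsum_bind_mul]
    congr 1
    have := ih (m + 1)
    rw [interactionLaw] at this
    rw [this]
    exact Finset.sum_congr rfl fun i _ => by rw [add_assoc, add_comm 1 i]

/-- The expected cost of finitely many steps is a lower bound of the learner's expected cost. -/
theorem ofReal_fixedValue_le_learnerCost (n : ℕ) :
    ENNReal.ofReal (fixedValue M L C b (costGain C) n ⟨[], [], M.init⟩) ≤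
      learnerCost M (fun k => C (b k)) L := by
  have h := tsum_law_mul_fixedValue M L C b n 0
  rw [interactionLaw, tsum_pure_mul] at h
  rw [h]
  simp only [zero_add]
  exact ENNReal.sum_le_tsum _

end Laws

/-! ### Hitting times and costs of stationary policies. -/

section Policies

variable {S : Type} {A : S → Type} [Fintype S] (M : MDP S A) (π : Policy A)

theorem hittingTime_eq_costToGo (s : S) :
    M.hittingTime π s = M.costToGo (fun _ => 1) π s := by
  simp [MDP.hittingTime, MDP.costToGo]

theorem policyLaw_succ_of_pure {s t : S} (h : M.P s (π s) = PMF.pure (some t)) (n : ℕ) :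
    M.policyLaw π s (n + 1) = M.policyLaw π t n := by
  induction n with
  | zero => simp [MDP.policyLaw, MDP.policyStep, h]
  | succ n ih => rw [MDP.policyLaw, ih, MDP.policyLaw]

theorem costToGo_of_pure (c : Pair A → ℝ≥0) {s t : S} (h : M.P s (π s) = PMF.pure (some t)) :
    M.costToGo c π s = c ⟨s, π s⟩ + M.costToGo c π t := by
  classical
  rw [MDP.costToGo, tsum_eq_zero_add' ENNReal.summable]
  congr 1
  · rw [Finset.sum_eq_single s]
    · simp [MDP.policyLaw]
    · intro t _ hts
      simp [MDP.policyLaw, hts]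
    · simp
  · simp only [policyLaw_succ_of_pure M π h, MDP.costToGo]

/-- Every policy with finite hitting times is proper. -/
theorem isProper_of_hittingTime_ne_top (h : ∀ s, M.hittingTime π s ≠ ⊤) : M.IsProper π := by
  intro s
  have h1 : ∀ n, ∑ t, M.policyLaw π s n (some t) = 1 - M.policyLaw π s n none := by
    intro n
    have h2 := (M.policyLaw π s n).tsum_coe
    rw [tsum_fintype, Fintype.sum_option] at h2
    rw [← h2, ENNReal.add_sub_cancel_left (PMF.apply_ne_top _ _)]
  -- The terms of the convergent series are the probabilities of not having reached the goal. They
  -- tend to zero, whereas a supremum below one would bound them away from zero.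
  have h3 := ENNReal.tendsto_atTop_zero_of_tsum_ne_top (h s)
  simp only [h1] at h3
  apply le_antisymm (iSup_le fun n => PMF.coe_le_one _ _)
  by_contra hlt
  rw [not_le] at hlt
  obtain ⟨n, hn⟩ := ((tendsto_order.mp h3).2 _ (tsub_pos_of_lt hlt)).exists
  have h4 : 1 - ⨆ n, M.policyLaw π s n none ≤ 1 - M.policyLaw π s n none :=
    tsub_le_tsub_left (le_iSup (fun n => M.policyLaw π s n none) n) _
  exact absurd hn (not_lt.mpr h4)

/-- From `s`, reach the goal with probability `1 / t` (at least if `t ≥ 1`), and stay otherwise. -/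
noncomputable def geometricStep [DecidableEq S] (s : S) (t : ℝ) : PMF (Option S) :=
  PMF.ofFintype (fun o => if o = none then min 1 (ENNReal.ofReal t⁻¹) else
    if o = some s then 1 - min 1 (ENNReal.ofReal t⁻¹) else 0) (by
    rw [Fintype.sum_option]
    simp)

variable [DecidableEq S]

theorem geometricStep_apply {s : S} {t : ℝ} (ht : 1 ≤ t) (o : Option S) :
    geometricStep s t o = if o = none then ENNReal.ofReal t⁻¹ else
      if o = some s then 1 - ENNReal.ofReal t⁻¹ else 0 := by
  have h : min 1 (ENNReal.ofReal t⁻¹) = ENNReal.ofReal t⁻¹ :=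
    min_eq_right (ENNReal.ofReal_le_one.mpr (inv_le_one_of_one_le₀ ht))
  simp only [geometricStep, PMF.ofFintype_apply, h]

theorem meanNext_of_geometricStep {s u : S} {a : A s} {t : ℝ} (ht : 1 ≤ t)
    (h : M.P s a = geometricStep u t) (f : Option S → ℝ) :
    meanNext M s a f = t⁻¹ * f none + (1 - t⁻¹) * f (some u) := by
  have h1 : t⁻¹ ≤ 1 := inv_le_one_of_one_le₀ ht
  have h0 : 0 ≤ t⁻¹ := by positivity
  rw [meanNext, Fintype.sum_option, h]
  congr 1
  · simp [geometricStep_apply ht, h0]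
  · rw [Finset.sum_eq_single u]
    · simp [geometricStep_apply ht, h0, ENNReal.toReal_sub_of_le (ENNReal.ofReal_le_one.mpr h1)]
    · intro v _ hv
      simp [geometricStep_apply ht, hv]
    · simp

theorem meanNext_of_pure {s : S} {a : A s} {o : Option S}
    (h : M.P s a = PMF.pure o) (f : Option S → ℝ) : meanNext M s a f = f o := by
  rw [meanNext, h, Finset.sum_eq_single o]
  · simp
  · intro v _ hv
    simp [PMF.pure_apply, hv]
  · simp

theorem policyLaw_of_geometricStep {s : S} {t : ℝ} (ht : 1 ≤ t)
    (h : M.P s (π s) = geometricStep s t) (n : ℕ) (u : S) :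
    M.policyLaw π s n (some u) = if u = s then (1 - ENNReal.ofReal t⁻¹) ^ n else 0 := by
  induction n generalizing u with
  | zero => simp [MDP.policyLaw]
  | succ n ih =>
    rw [MDP.policyLaw, PMF.bind_apply, tsum_fintype, Fintype.sum_option,
      Finset.sum_eq_single s]
    · simp [MDP.policyStep, ih, h, geometricStep_apply ht, pow_succ]
    · intro v _ hv
      simp [ih, hv]
    · simp

theorem costToGo_of_geometricStep (c : Pair A → ℝ≥0) {s : S} {t : ℝ} (ht : 1 ≤ t)
    (h : M.P s (π s) = geometricStep s t) :
    M.costToGo c π s = ENNReal.ofReal t * c ⟨s, π s⟩ := by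
  have ht0 : 0 < t := by linarith
  have h1 : ∀ n, ∑ u, M.policyLaw π s n (some u) * (c ⟨u, π u⟩ : ℝ≥0∞) =
      (1 - ENNReal.ofReal t⁻¹) ^ n * c ⟨s, π s⟩ := by
    intro n
    rw [Finset.sum_eq_single s]
    · simp [policyLaw_of_geometricStep M π ht h]
    · intro v _ hv
      simp [policyLaw_of_geometricStep M π ht h, hv]
    · simp
  simp only [MDP.costToGo, h1, ENNReal.tsum_mul_right, ENNReal.tsum_geometric]
  rw [ENNReal.sub_sub_cancel ENNReal.one_ne_top
    (ENNReal.ofReal_le_one.mpr (inv_le_one_of_one_le₀ ht)), ENNReal.ofReal_inv_of_pos ht0, inv_inv]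

end Policies

/-! ### Potentials that add up over episodes. -/

section Episodic

variable {S : Type} {A : S → Type} [Fintype S] [∀ s, Fintype (A s)] {K : ℕ} {ρ : Type} [Fintype ρ]
  {M : MDP S A} {C : ρ → Pair A → ℝ≥0} {ν : ρ → ℝ} {g : ρ → (x : Config A) → A x.state → ℝ}

/-- The potential that is worth `v s` in the state `s` of the current episode and `v₀` for each of
the later episodes. -/
noncomputable def episodicPotential (A : S → Type) (K : ℕ) (v₀ : ℝ) (v : S → ℝ) (x : Config A) :
    ℝ :=
  if x.past.length < K then ((K : ℝ) - 1 - x.past.length) * v₀ + v x.state else 0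

theorem episodicPotential_stepTo_none {v₀ : ℝ} {v : S → ℝ} (hv : v M.init = v₀) (d : Pair A → ℝ≥0) {x : Config A}
    (a : A x.state) (hx : x.past.length < K) :
    episodicPotential A K v₀ v (stepTo M d x a none) =
      ((K : ℝ) - 1 - x.past.length) * v₀ := by
  simp only [episodicPotential, stepTo, hv, List.length_append, List.length_singleton]
  split_ifs with h
  · push_cast
    ring
  · have : K = x.past.length + 1 := by omega
    rw [this]
    push_cast
    ring

theorem bellman_episodicPotential (hν : ∑ r, ν r = 1) {v₀ : ℝ} {v : S → ℝ} (hv : v M.init = v₀) {x : Config A} (a : A x.state)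
    (hx : x.past.length < K) :
    bellman M C ν g (episodicPotential A K v₀ v) x a =
      ∑ r, ν r * g r x a + ((K : ℝ) - 1 - x.past.length) * v₀ +
        meanNext M x.state a fun o => o.elim 0 v := by
  have h : ∀ r o, episodicPotential A K v₀ v (stepTo M (C r) x a o) =
      ((K : ℝ) - 1 - x.past.length) * v₀ + o.elim 0 v := by
    intro r o
    cases o with
    | none => rw [episodicPotential_stepTo_none hv _ a hx]; simp
    | some t => simp [episodicPotential, stepTo, hx]
  simp only [bellman, h, meanNext_add, meanNext_const, mul_add, Finset.sum_add_distrib,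
    ← Finset.sum_mul, hν, one_mul]
  ring

theorem episodicPotential_nonneg {v₀ : ℝ} {v : S → ℝ} (hv₀ : 0 ≤ v₀) (hv : ∀ s, 0 ≤ v s)
    (x : Config A) : 0 ≤ episodicPotential A K v₀ v x := by
  rw [episodicPotential]
  split_ifs with h
  · have : (x.past.length : ℝ) + 1 ≤ K := by exact_mod_cast h
    exact add_nonneg (mul_nonneg (by linarith) hv₀) (hv _)
  · exact le_rfl

theorem episodicPotential_le {v₀ B : ℝ} {v : S → ℝ} (hv₀ : 0 ≤ v₀) (hB : 0 ≤ B)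
    (hv : ∀ s, v s ≤ B) (x : Config A) : episodicPotential A K v₀ v x ≤ K * v₀ + B := by
  rw [episodicPotential]
  split_ifs with h
  · have : ((K : ℝ) - 1 - x.past.length) * v₀ ≤ K * v₀ :=
      mul_le_mul_of_nonneg_right (by linarith [(x.past.length : ℕ).cast_nonneg (α := ℝ)]) hv₀
    linarith [hv x.state]
  · positivity

theorem episodicPotential_start (hK : 0 < K) (v : S → ℝ) (s : S) :
    episodicPotential A K (v s) v ⟨[], [], s⟩ = K * v s := by
  simp only [episodicPotential, List.length_nil, hK, if_true]
  push_cast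
  ring

end Episodic

/-! ### The hard instance and its random costs. -/

section Construction

variable {N : ℕ}

/-- The numbers of actions: the initial state `0` has one action per arm, the fast state `1` has one
action, and in the state of each arm one can stay or leave. -/
def hardActions (N : ℕ) : Fin (N + 3) → ℕ :=
  Fin.cases (N + 1) (Fin.cases 1 fun _ => 2)

/-- The state of an arm. -/
def arm (i : Fin (N + 1)) : Fin (N + 3) := i.succ.succ

/-- The transitions: an arm is entered from the initial state; staying in it leads to the goal with
probability `1 / T`; leaving it leads to the fast state, from where the goal is reached with
probability `1 / D`. -/
noncomputable def hardStep (D T : ℝ) :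
    (s : Fin (N + 3)) → Fin (hardActions N s) → PMF (Option (Fin (N + 3))) :=
  Fin.cases (motive := fun s => Fin (hardActions N s) → PMF (Option (Fin (N + 3))))
    (fun (i : Fin (N + 1)) => PMF.pure (some (arm i)))
    (Fin.cases (motive := fun s => Fin (hardActions N s.succ) → PMF (Option (Fin (N + 3))))
      (fun _ => geometricStep 1 D)
      (fun i (a : Fin 2) => if a = 0 then geometricStep (arm i) T else PMF.pure (some 1)))

/-- The Markov decision process of the lower bound. -/
noncomputable def hardMDP (N : ℕ) (D T : ℝ) :
    MDP (Fin (N + 3)) (fun s => Fin (hardActions N s)) where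
  init := 0
  P := hardStep D T

/-- The pair of choosing an arm in the initial state. -/
def choosePair (i : Fin (N + 1)) : Pair (fun s => Fin (hardActions N s)) :=
  ⟨0, (i : Fin (N + 1))⟩

/-- The only pair of the fast state. -/
def fastPair (N : ℕ) : Pair (fun s => Fin (hardActions N s)) := ⟨1, (0 : Fin 1)⟩

/-- The pair of staying in an arm. -/
def stayPair (i : Fin (N + 1)) : Pair (fun s => Fin (hardActions N s)) := ⟨arm i, (0 : Fin 2)⟩

/-- The pair of leaving an arm. -/
def leavePair (i : Fin (N + 1)) : Pair (fun s => Fin (hardActions N s)) := ⟨arm i, (1 : Fin 2)⟩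

theorem pair_cases {motive : Pair (fun s => Fin (hardActions N s)) → Prop}
    (choose : ∀ i, motive (choosePair i)) (fast : motive (fastPair N))
    (stay : ∀ i, motive (stayPair i)) (leave : ∀ i, motive (leavePair i)) :
    ∀ y, motive y := by
  rintro ⟨s, a⟩
  induction s using Fin.cases with
  | zero => exact choose a
  | succ s =>
    induction s using Fin.cases with
    | zero =>
      have : a = (0 : Fin 1) := Subsingleton.elim (α := Fin 1) _ _
      rw [this]
      exact fast
    | succ i =>
      have h : ∀ a : Fin 2, motive ⟨arm i, a⟩ := by
        intro a
        match a with
        | 0 => exact stay i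
        | 1 => exact leave i
      exact h a

theorem config_cases
    {motive : (x : Config (fun s => Fin (hardActions N s))) → Fin (hardActions N x.state) → Prop}
    (choose : ∀ past cur i, motive ⟨past, cur, 0⟩ (choosePair i).2)
    (fast : ∀ past cur, motive ⟨past, cur, 1⟩ (fastPair N).2)
    (stay : ∀ past cur i, motive ⟨past, cur, arm i⟩ (stayPair i).2)
    (leave : ∀ past cur i, motive ⟨past, cur, arm i⟩ (leavePair i).2) :
    ∀ x a, motive x a := by
  rintro ⟨past, cur, s⟩ a
  exact pair_cases (motive := fun y => motive ⟨past, cur, y.1⟩ y.2) (choose past cur)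
    (fast past cur) (stay past cur) (leave past cur) ⟨s, a⟩

variable {D T : ℝ}

theorem step_choose (i : Fin (N + 1)) :
    (hardMDP N D T).P 0 (choosePair i).2 = PMF.pure (some (arm i)) := rfl

theorem step_fast : (hardMDP N D T).P 1 (fastPair N).2 = geometricStep 1 D := rfl

theorem step_stay (i : Fin (N + 1)) :
    (hardMDP N D T).P (arm i) (stayPair i).2 = geometricStep (arm i) T := rfl

theorem step_leave (i : Fin (N + 1)) :
    (hardMDP N D T).P (arm i) (leavePair i).2 = PMF.pure (some 1) := rfl

/-- The costs of an episode: choosing an arm is free; staying costs `p` in the arm `0` and a random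
bit in the other arms; all other pairs cost `1`. -/
def hardCost (p : ℝ≥0) (r : Fin (N + 1) → Bool) :
    Pair (fun s => Fin (hardActions N s)) → ℝ≥0 := fun y =>
  Fin.cases (motive := fun s => Fin (hardActions N s) → ℝ≥0) (fun _ => 0)
    (Fin.cases (motive := fun s => Fin (hardActions N s.succ) → ℝ≥0) (fun _ => 1)
      (fun i (a : Fin 2) => if a = 0 then (if i = 0 then p else if r i then 1 else 0) else 1))
    y.1 y.2

variable {p : ℝ≥0} {r : Fin (N + 1) → Bool}

theorem hardCost_choose (i : Fin (N + 1)) : hardCost p r (choosePair i) = 0 := rfl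

theorem hardCost_fast : hardCost p r (fastPair N) = 1 := rfl

theorem hardCost_stay (i : Fin (N + 1)) :
    hardCost p r (stayPair i) = if i = 0 then p else if r i then 1 else 0 := rfl

theorem hardCost_leave (i : Fin (N + 1)) : hardCost p r (leavePair i) = 1 := rfl

theorem hardCost_le_one (hp : p ≤ 1) (y) : hardCost p r y ≤ 1 := by
  refine pair_cases (motive := fun y => hardCost p r y ≤ 1) ?_ ?_ ?_ ?_ y
  · simp [hardCost_choose]
  · simp [hardCost_fast]
  · intro i
    rw [hardCost_stay]
    split_ifs <;> simp [hp]
  · simp [hardCost_leave]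

/-- The function on states with the given values at the initial state, the fast state, the arms. -/
def stateFun (z₀ z₁ : ℝ) (z : Fin (N + 1) → ℝ) : Fin (N + 3) → ℝ :=
  Fin.cases z₀ (Fin.cases z₁ z)

theorem stateFun_cases {motive : Fin (N + 3) → Prop} (h0 : motive 0) (h1 : motive 1)
    (h2 : ∀ i, motive (arm i)) (s) : motive s := by
  induction s using Fin.cases with
  | zero => exact h0
  | succ s =>
    induction s using Fin.cases with
    | zero => exact h1
    | succ i => exact h2 i

/-- The gain that counts how often the arm `J` is chosen. -/
noncomputable def chooseGain (J : Fin (N + 1))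
    (x : Config (fun s => Fin (hardActions N s))) (a : Fin (hardActions N x.state)) : ℝ :=
  if x.state = 0 ∧ a.val = J.val then 1 else 0

theorem arm_ne_zero (i : Fin (N + 1)) : arm i ≠ 0 := Fin.succ_ne_zero _

theorem one_ne_arm (i : Fin (N + 1)) : (1 : Fin (N + 3)) ≠ arm i :=
  fun h => Fin.succ_ne_zero i (Fin.succ_injective _ h.symm)

theorem arm_injective : Function.Injective (arm (N := N)) :=
  (Fin.succ_injective _).comp (Fin.succ_injective _)

theorem chooseGain_choose (J i : Fin (N + 1)) (past cur) :
    chooseGain J ⟨past, cur, 0⟩ (choosePair i).2 = if i = J then 1 else 0 := by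
  have h : (choosePair i).2.val = J.val ↔ i = J := Fin.ext_iff.symm
  simp only [chooseGain, h, true_and]

theorem chooseGain_of_ne (J : Fin (N + 1)) (x : Config (fun s => Fin (hardActions N s)))
    (a : Fin (hardActions N x.state)) (hx : x.state ≠ 0) : chooseGain J x a = 0 := by
  simp [chooseGain, hx]

theorem chooseGain_nonneg (J : Fin (N + 1)) (x : Config (fun s => Fin (hardActions N s)))
    (a : Fin (hardActions N x.state)) : 0 ≤ chooseGain J x a := by
  rw [chooseGain]
  split_ifs <;> norm_num

/-- The mean cost of an arm when the arm `J` is the best one. -/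
noncomputable def armMean (p e : ℝ) (J i : Fin (N + 1)) : ℝ :=
  if i = 0 then p else if i = J then p - e else p + e

/-- The weight of a bit that equals `true` with probability `q`. -/
def bitWeight (q : ℝ) (β : Bool) : ℝ := if β then q else 1 - q

/-- The weight of a row of bits when the arm `J` is the best one. -/
noncomputable def rowWeight (p e : ℝ) (J : Fin (N + 1)) (r : Fin (N + 1) → Bool) : ℝ :=
  ∏ i, bitWeight (armMean p e J i) (r i)

theorem sum_bitWeight (q : ℝ) : ∑ β, bitWeight q β = 1 := by
  simp [bitWeight]

variable {e : ℝ} (J : Fin (N + 1))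

theorem sum_rowWeight (p : ℝ) : ∑ r, rowWeight p e J r = 1 :=
  sum_prod_eq_one _ fun _ => sum_bitWeight _

theorem armMean_mem {p : ℝ} (he : 0 ≤ e) (hep : e ≤ p / 2) (i : Fin (N + 1)) :
    p / 2 ≤ armMean p e J i ∧ armMean p e J i ≤ 3 * p / 2 := by
  rw [armMean]
  split_ifs <;> constructor <;> linarith

theorem rowWeight_nonneg {p : ℝ} (he : 0 ≤ e) (hep : e ≤ p / 2) (hp : p ≤ 1 / 4)
    (r : Fin (N + 1) → Bool) : 0 ≤ rowWeight p e J r := by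
  refine Finset.prod_nonneg fun i _ => ?_
  have := armMean_mem J he hep i
  rw [bitWeight]
  split_ifs <;> linarith

/-- The mean cost of staying in an arm. -/
theorem sum_rowWeight_mul_stay (i : Fin (N + 1)) :
    ∑ r, rowWeight p e J r * (hardCost p r (stayPair i) : ℝ) = armMean p e J i := by
  simp only [hardCost_stay]
  by_cases hi : i = 0
  · simp only [hi, if_true, ← Finset.sum_mul, sum_rowWeight, one_mul, armMean]
  · simp only [hi, if_false]
    have := sum_prod_mul_coord (fun i => bitWeight (armMean p e J i)) (fun _ => sum_bitWeight _) i
      fun β => ((if β then 1 else 0 : ℝ≥0) : ℝ)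
    refine this.trans ?_
    simp [bitWeight]

end Construction

/-! ### Regret decomposition and number of choices. -/

section Bounds

variable {N K : ℕ} {D T e : ℝ} {p : ℝ≥0} {L : Learner (fun s => Fin (hardActions N s))}

/-- The regret decomposition: a learner that does not choose the best arm `J` in an episode loses at
least `e * T`. -/
theorem cost_lower_bound (hD : 1 ≤ D) (hT : D + 1 ≤ T) (he : 0 ≤ e) (hep : e ≤ p / 2)
    (hpT : p * T = D / 4) (hp4 : (p : ℝ) ≤ 1 / 4) (hK : 0 < K) (J : Fin (N + 1)) (n : ℕ) :
    n * (K * ((armMean p e J J + e) * T)) ≤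
      n * (meanValue (hardMDP N D T) L (hardCost p) K (rowWeight p e J) (costGain (hardCost p)) n
          ⟨[], [], 0⟩ +
        e * T * meanValue (hardMDP N D T) L (hardCost p) K (rowWeight p e J)
          (fun _ x a => chooseGain J x a) n ⟨[], [], 0⟩) +
      (K * (D + T) + (D + T)) * (K * (1 + T)) := by
  have hν := rowWeight_nonneg J he hep hp4
  have hν1 := sum_rowWeight J (e := e) p
  have hT1 : 1 ≤ T := by linarith
  have hT0 : 0 < T := by linarith
  have hD0 : 0 < D := by linarith
  have hmean : ∀ i, 0 ≤ armMean p e J i * T ∧ armMean p e J i * T ≤ 3 * D / 8 := by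
    intro i
    obtain ⟨h1, h2⟩ := armMean_mem J he hep i
    have hp0 : (0 : ℝ) ≤ p := p.coe_nonneg
    constructor
    · exact mul_nonneg (by linarith) hT0.le
    · calc armMean p e J i * T ≤ (3 * p / 2) * T := mul_le_mul_of_nonneg_right h2 hT0.le
        _ = 3 / 2 * (p * T) := by ring
        _ = 3 * D / 8 := by rw [hpT]; ring
  have heT : e * T ≤ D / 8 := by
    calc e * T ≤ p / 2 * T := mul_le_mul_of_nonneg_right hep hT0.le
      _ = p * T / 2 := by ring
      _ = D / 8 := by rw [hpT]; ring
  have heT0 : 0 ≤ e * T := by positivity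
  -- At the initial state `v` is the cost of an arm with mean `armMean J + e`, a lower bound for
  -- every arm other than `J`. Choosing `J` is cheaper by `e * T`, which the added gain `e * T *
  -- chooseGain J` makes up for.
  set v : Fin (N + 3) → ℝ := stateFun ((armMean p e J J + e) * T) D fun i => armMean p e J i * T
  -- Bounds the expected remaining length of an episode. The value `T` in an arm also covers
  -- leaving, because `D + 1 ≤ T`.
  set w : Fin (N + 3) → ℝ := stateFun (1 + T) D fun _ => T
  have hv0 : v 0 = (armMean p e J J + e) * T := rfl
  have hw0 : w 0 = 1 + T := rfl
  have hvB : ∀ s, v s ≤ D + T := by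
    refine stateFun_cases ?_ ?_ ?_
    · rw [hv0, add_mul]; linarith [(hmean J).2]
    · change D ≤ _; linarith
    · intro i; change armMean p e J i * T ≤ _; linarith [(hmean i).2]
  have hvn : 0 ≤ v 0 := by rw [hv0, add_mul]; linarith [(hmean J).1]
  have hwn : ∀ s, 0 ≤ w s := by
    refine stateFun_cases ?_ ?_ ?_
    · rw [hw0]; linarith
    · exact hD0.le
    · intro i; exact hT0.le
  have hcost0 : ∀ r x a, 0 ≤ costGain (hardCost p) r x a + e * T * chooseGain J x a :=
    fun r x a => add_nonneg (costGain_nonneg _ r x a) (mul_nonneg heT0 (chooseGain_nonneg J x a))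
  have key := potential_le_meanValue (M := hardMDP N D T) (L := L) (C := hardCost p) (K := K)
    (g := fun r x a => costGain (hardCost p) r x a + e * T * chooseGain J x a)
    (V := episodicPotential _ K (v 0) v) (H := episodicPotential _ K (w 0) w)
    (B := K * (D + T) + (D + T)) hν hν1 hcost0 (by positivity)
    (fun x hx => by simp [episodicPotential, hx.not_gt])
    (fun x => (episodicPotential_le hvn (by positivity) hvB x).trans (by gcongr; exact hvB 0))
    ?_ (episodicPotential_nonneg (hwn 0) hwn) ?_ n ⟨[], [], 0⟩
  · rw [episodicPotential_start hK, episodicPotential_start hK, hv0, hw0, meanValue_add,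
      meanValue_mul] at key
    exact key
  · intro x hx a
    rw [bellman_episodicPotential (M := hardMDP N D T) hν1 (v₀ := v 0) (v := v) rfl a hx, episodicPotential, if_pos hx]
    induction x, a using config_cases with
    | choose past cur i =>
      rw [meanNext_of_pure _ (step_choose i)]
      simp only [chooseGain_choose, costGain]
      have h1 : ∀ r, hardCost p r ⟨0, (choosePair i).2⟩ = 0 := fun r => rfl
      simp only [h1, ← Finset.sum_mul, hν1]
      have h2 : v (arm i) = armMean p e J i * T := rfl
      simp only [Option.elim, h2, hv0]
      have h4 : (armMean p e J J + e) * T ≤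
          (e * T * if i = J then 1 else 0) + armMean p e J i * T := by
        by_cases hi : i = J
        · simp only [hi, if_true]; linarith
        · simp only [hi, if_false, mul_zero, zero_add]
          refine mul_le_mul_of_nonneg_right ?_ hT0.le
          rw [armMean, armMean]
          by_cases hJ : J = 0
          · subst hJ; simp [hi]
          · by_cases hi0 : i = 0
            · simp [hi0, hJ]
            · simp only [hi0, hJ, hi, if_false, if_true]; linarith
      simp only [NNReal.coe_zero, zero_add, one_mul]
      linarith
    | fast past cur =>
      rw [meanNext_of_geometricStep _ hD step_fast]
      have h0 : ∀ r, costGain (hardCost p) r ⟨past, cur, 1⟩ (fastPair N).2 = 1 := fun r => rfl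
      have h1 : v 1 = D := rfl
      simp only [h0, chooseGain_of_ne J ⟨past, cur, 1⟩ (fastPair N).2 (by simp), mul_zero,
        add_zero, mul_one, hν1, Option.elim, h1]
      have : (1 - D⁻¹) * D = D - 1 := by field_simp
      linarith
    | stay past cur i =>
      rw [meanNext_of_geometricStep _ hT1 (step_stay i)]
      have h0 : ∀ r, costGain (hardCost p) r ⟨past, cur, arm i⟩ (stayPair i).2 =
        hardCost p r (stayPair i) := fun r => rfl
      have h1 : v (arm i) = armMean p e J i * T := rfl
      simp only [h0, chooseGain_of_ne J ⟨past, cur, arm i⟩ (stayPair i).2 (arm_ne_zero i), mul_zero,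
        add_zero, sum_rowWeight_mul_stay, Option.elim, h1]
      have : (1 - T⁻¹) * (armMean p e J i * T) = armMean p e J i * T - armMean p e J i := by
        field_simp
      linarith
    | leave past cur i =>
      rw [meanNext_of_pure _ (step_leave i)]
      have h0 : ∀ r, costGain (hardCost p) r ⟨past, cur, arm i⟩ (leavePair i).2 = 1 := fun r => rfl
      have h1 : v (arm i) = armMean p e J i * T := rfl
      have h3 : v 1 = D := rfl
      simp only [h0, chooseGain_of_ne J ⟨past, cur, arm i⟩ (leavePair i).2 (arm_ne_zero i),
        mul_zero, add_zero, mul_one, hν1, Option.elim, h1, h3]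
      -- Leaving costs `1 + D`, whereas staying costs at most `3D/8` on average. This is what `p * T
      -- = D / 4` is for.
      linarith [(hmean i).2]
  · intro x hx a
    rw [bellman_episodicPotential (M := hardMDP N D T) hν1 (v₀ := w 0) (v := w) rfl a hx, episodicPotential, if_pos hx]
    simp only [mul_one, hν1]
    induction x, a using config_cases with
    | choose past cur i =>
      rw [meanNext_of_pure _ (step_choose i)]
      have h1 : w (arm i) = T := rfl
      simp only [Option.elim, h1, hw0]
      linarith
    | fast past cur =>
      rw [meanNext_of_geometricStep _ hD step_fast]
      have h1 : w 1 = D := rfl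
      simp only [Option.elim, h1]
      have : (1 - D⁻¹) * D = D - 1 := by field_simp
      linarith
    | stay past cur i =>
      rw [meanNext_of_geometricStep _ hT1 (step_stay i)]
      have h1 : w (arm i) = T := rfl
      simp only [Option.elim, h1]
      have : (1 - T⁻¹) * T = T - 1 := by field_simp
      linarith
    | leave past cur i =>
      rw [meanNext_of_pure _ (step_leave i)]
      have h1 : w (arm i) = T := rfl
      have h3 : w 1 = D := rfl
      simp only [Option.elim, h1, h3]
      linarith

/-- In each episode exactly one arm is chosen. -/
theorem sum_choose_le (hD : 1 ≤ D) (hT : D + 1 ≤ T) (hK : 0 < K)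
    {ν : (Fin (N + 1) → Bool) → ℝ} (hν : ∀ r, 0 ≤ ν r) (hν1 : ∑ r, ν r = 1) (n : ℕ) :
    ∑ J, meanValue (hardMDP N D T) L (hardCost p) K ν (fun _ x a => chooseGain J x a) n
      ⟨[], [], 0⟩ ≤ K := by
  have hT1 : 1 ≤ T := by linarith
  set v : Fin (N + 3) → ℝ := stateFun 1 0 fun _ => 0
  have hv0 : v 0 = 1 := rfl
  have hvn : ∀ s, 0 ≤ v s := by
    refine stateFun_cases ?_ ?_ ?_
    · rw [hv0]; norm_num
    · exact le_rfl
    · intro i; exact le_rfl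
  have key := meanValue_le_potential (M := hardMDP N D T) (L := L) (C := hardCost p) (K := K)
    (g := fun _ x a => ∑ J, chooseGain J x a) (V := episodicPotential _ K (v 0) v) hν
    (episodicPotential_nonneg (hvn 0) hvn) ?_ n ⟨[], [], 0⟩
  · rw [episodicPotential_start hK, hv0, mul_one] at key
    rw [← meanValue_sum]
    exact key
  · intro x hx a
    rw [bellman_episodicPotential (M := hardMDP N D T) hν1 (v₀ := v 0) (v := v) rfl a hx, episodicPotential, if_pos hx]
    simp only [← Finset.sum_mul, hν1, one_mul]
    induction x, a using config_cases with
    | choose past cur i =>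
      rw [meanNext_of_pure _ (step_choose i)]
      have h1 : v (arm i) = 0 := rfl
      simp only [chooseGain_choose, Option.elim, h1, hv0]
      simp
      linarith
    | fast past cur =>
      rw [meanNext_of_geometricStep _ hD step_fast]
      have h1 : v 1 = 0 := rfl
      simp [chooseGain_of_ne _ ⟨past, cur, 1⟩ (fastPair N).2 (by simp), h1]
    | stay past cur i =>
      rw [meanNext_of_geometricStep _ hT1 (step_stay i)]
      have h1 : v (arm i) = 0 := rfl
      simp [chooseGain_of_ne _ ⟨past, cur, arm i⟩ (stayPair i).2 (arm_ne_zero i), h1]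
    | leave past cur i =>
      rw [meanNext_of_pure _ (step_leave i)]
      have h1 : v 1 = 0 := rfl
      have h3 : v (arm i) = 0 := rfl
      simp [chooseGain_of_ne _ ⟨past, cur, arm i⟩ (leavePair i).2 (arm_ne_zero i), h1, h3]

end Bounds

/-! ### Change of measure and triangular discrimination. -/

section Information

/-- The convex function that generates the triangular discrimination. -/
noncomputable def discrimination (z : ℝ) : ℝ := (1 - z) ^ 2 / (1 + z)

theorem discrimination_nonneg {z : ℝ} (hz : 0 ≤ z) : 0 ≤ discrimination z := by
  rw [discrimination]; positivity

/-- The tangent line of this convex function at `z = 3`. With the constant `5/3` below `2`, the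
final count leaves room even when there are only two arms. -/
theorem le_discrimination {z : ℝ} (hz : 0 ≤ z) : z ≤ 5 / 3 + 4 / 3 * discrimination z := by
  have h : 0 < 1 + z := by linarith
  rw [discrimination, ← sub_nonneg]
  have : 5 / 3 + 4 / 3 * ((1 - z) ^ 2 / (1 + z)) - z = (z - 3) ^ 2 / (3 * (1 + z)) := by
    field_simp; ring
  rw [this]
  positivity

/-- Observing a bit increases the triangular discrimination by at most four times the chi-square
divergence. -/
theorem discrimination_step {a b z : ℝ} (hz : 0 < z) (ha : 0 < a) (hab : a ≤ b) (hb : b < 1) :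
    b * discrimination (z * (a / b)) + (1 - b) * discrimination (z * ((1 - a) / (1 - b))) ≤
      discrimination z + 4 * (b - a) ^ 2 / (b * (1 - b)) := by
  have hb0 : 0 < b := by linarith
  have hb1 : 0 < 1 - b := by linarith
  have ha1 : 0 < 1 - a := by linarith
  have hX : 0 < b + z * a := by positivity
  have hY : 0 < 1 - b + z * (1 - a) := by positivity
  have hz1 : 0 < 1 + z := by linarith
  have e1 : discrimination (z * (a / b)) = (b - z * a) ^ 2 / (b * (b + z * a)) := by
    rw [discrimination]; field_simp
  have e2 : discrimination (z * ((1 - a) / (1 - b))) =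
      (1 - b - z * (1 - a)) ^ 2 / ((1 - b) * (1 - b + z * (1 - a))) := by
    rw [discrimination]; field_simp
  -- The increment is computed exactly. Its denominator has the factors `b + z a ≥ b`, `1 - b + z (1
  -- - a) ≥ (1 - b) z` (by `a ≤ b`) and `1 + z ≥ z`, so the `z ^ 2` cancels and the bound is uniform
  -- in `z`; the increment of `(1 - z) ^ 2` would keep that factor.
  have e3 : b * discrimination (z * (a / b)) +
      (1 - b) * discrimination (z * ((1 - a) / (1 - b))) = discrimination z +
        4 * (z ^ 2 * (b - a) ^ 2 / ((b + z * a) * (1 - b + z * (1 - a)) * (1 + z))) := by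
    rw [e1, e2, discrimination]
    field_simp
    ring
  rw [e3, mul_div_assoc 4 ((b - a) ^ 2)]
  refine add_le_add_right (mul_le_mul_of_nonneg_left ?_ (by norm_num)) _
  rw [div_le_div_iff₀ (by positivity) (by positivity)]
  have h1 : b * ((1 - b) * z) * z ≤
      (b + z * a) * (1 - b + z * (1 - a)) * (1 + z) := by
    gcongr
    · nlinarith
    · nlinarith
    · linarith
  nlinarith [mul_le_mul_of_nonneg_left h1 (sq_nonneg (b - a))]

variable {N K : ℕ} {D T e : ℝ} {p : ℝ≥0} {L : Learner (fun s => Fin (hardActions N s))}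

/-- The costs of the pairs of an episode that are revealed at its end. -/
def reveal {S : Type} {A : S → Type} (d : Pair A → ℝ≥0) (l : List (Pair A)) :
    List (Pair A × ℝ≥0) :=
  l.map fun y => (y, d y)

open Classical in
/-- The likelihood ratio of the observations of an episode: arm `J` is the best one, against arm
`0` is the best one. -/
noncomputable def episodeRatio (p e : ℝ) (J : Fin (N + 1))
    (l : List (Pair (fun s => Fin (hardActions N s)) × ℝ≥0)) : ℝ :=
  if (stayPair J, 1) ∈ l then (p - e) / (p + e)
  else if (stayPair J, 0) ∈ l then (1 - (p - e)) / (1 - (p + e)) else 1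

theorem mem_reveal {S : Type} {A : S → Type} {d : Pair A → ℝ≥0} {l : List (Pair A)} {y : Pair A}
    {z : ℝ≥0} : (y, z) ∈ reveal d l ↔ y ∈ l ∧ d y = z := by
  simp only [reveal, List.mem_map, Prod.mk.injEq]
  constructor
  · rintro ⟨y', h, rfl, rfl⟩
    exact ⟨h, rfl⟩
  · rintro ⟨h, rfl⟩
    exact ⟨y, h, rfl, rfl⟩

/-- All visits to the pair within an episode show the same bit, so the bit counts once however long
the learner stays. -/
theorem episodeRatio_of_mem {J : Fin (N + 1)} (hJ : J ≠ 0)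
    {l : List (Pair (fun s => Fin (hardActions N s)))} (hl : stayPair J ∈ l)
    (r : Fin (N + 1) → Bool) :
    episodeRatio p e J (reveal (hardCost p r) l) =
      bitWeight (p - e) (r J) / bitWeight (p + e) (r J) := by
  simp only [episodeRatio, mem_reveal, hl, true_and, hardCost_stay, hJ, if_false]
  cases r J <;> simp [bitWeight]

theorem episodeRatio_of_notMem {J : Fin (N + 1)}
    {l : List (Pair (fun s => Fin (hardActions N s)))} (hl : stayPair J ∉ l)
    (d : Pair (fun s => Fin (hardActions N s)) → ℝ≥0) :
    episodeRatio p e J (reveal d l) = 1 := by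
  simp [episodeRatio, mem_reveal, hl]

theorem hardCost_update {J : Fin (N + 1)} (r : Fin (N + 1) → Bool) (β : Bool) :
    ∀ y, y ≠ stayPair J → hardCost p (Function.update r J β) y = hardCost p r y := by
  intro y
  induction y using pair_cases with
  | choose i => exact fun _ => rfl
  | fast => exact fun _ => rfl
  | leave i => exact fun _ => rfl
  | stay i =>
    intro h
    have hi : i ≠ J := fun h' => h (by rw [h'])
    simp only [hardCost_stay, Function.update_of_ne hi]

theorem reveal_update {J : Fin (N + 1)} {l : List (Pair (fun s => Fin (hardActions N s)))}
    (hl : stayPair J ∉ l) (r : Fin (N + 1) → Bool) (β : Bool) :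
    reveal (hardCost p (Function.update r J β)) l = reveal (hardCost p r) l := by
  refine List.map_congr_left fun y hy => ?_
  rw [hardCost_update r β y fun h => hl (h ▸ hy)]

theorem armMean_self {J : Fin (N + 1)} (hJ : J ≠ 0) (p e : ℝ) :
    armMean p e J J = p - e ∧ armMean p e 0 J = p + e := by
  simp [armMean, hJ]

theorem armMean_of_ne {i J : Fin (N + 1)} (hi : i ≠ J) (p e : ℝ) :
    armMean p e J i = armMean p e 0 i := by
  by_cases h : i = 0 <;> simp [armMean, hi, h]

/-- Change of measure for a single episode. The two row laws differ only in the `J`-th bit; either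
that bit is revealed and the ratio reweights it, or nothing revealed depends on it. -/
theorem sum_rowWeight_reveal {J : Fin (N + 1)} (hJ : J ≠ 0) (h0 : 0 < p + e) (h1 : p + e < 1)
    (l : List (Pair (fun s => Fin (hardActions N s))))
    (F : List (Pair (fun s => Fin (hardActions N s)) × ℝ≥0) → ℝ) :
    ∑ r, rowWeight p e J r * F (reveal (hardCost p r) l) =
      ∑ r, rowWeight p e 0 r * (episodeRatio p e J (reveal (hardCost p r) l) *
        F (reveal (hardCost p r) l)) := by
  unfold rowWeight
  rw [sum_prod_mul_eq_sum_update (fun i => bitWeight (armMean p e 0 i))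
      (fun i => bitWeight (armMean p e J i)) J (sum_bitWeight _)
      (fun k hk => by rw [armMean_of_ne hk]) fun r => F (reveal (hardCost p r) l),
    sum_prod_mul_eq_sum_update (fun i => bitWeight (armMean p e 0 i))
      (fun i => bitWeight (armMean p e 0 i)) J (sum_bitWeight _)
      (fun k hk => rfl) fun r => episodeRatio p e J (reveal (hardCost p r) l) *
        F (reveal (hardCost p r) l)]
  refine Finset.sum_congr rfl fun b _ => ?_
  congr 1
  rw [(armMean_self hJ p e).1, (armMean_self hJ p e).2]
  by_cases hl : stayPair J ∈ l
  · refine Finset.sum_congr rfl fun β _ => ?_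
    rw [episodeRatio_of_mem hJ hl, Function.update_self, ← mul_assoc]
    congr 1
    rw [mul_div_cancel₀]
    rw [bitWeight]
    split_ifs
    · exact h0.ne'
    · linarith
  · simp only [reveal_update hl, episodeRatio_of_notMem hl, one_mul, ← Finset.sum_mul,
      sum_bitWeight]

-- The ratio moves only if the bit of arm `J` is revealed, and then `discrimination_step` applies
-- with success probabilities `p - e` and `p + e`.
open Classical in
theorem sum_discrimination_le {J : Fin (N + 1)} (hJ : J ≠ 0) (he : 0 ≤ e) (hep : e < p)
    (h1 : p + e < 1) {z : ℝ} (hz : 0 < z) (l : List (Pair (fun s => Fin (hardActions N s)))) :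
    ∑ r, rowWeight p e 0 r * discrimination (z * episodeRatio p e J (reveal (hardCost p r) l)) ≤
      discrimination z +
        4 * ((p + e) - (p - e)) ^ 2 / ((p + e) * (1 - (p + e))) * if stayPair J ∈ l then 1 else 0 := by
  by_cases hl : stayPair J ∈ l
  · have h := sum_prod_mul_coord (fun i => bitWeight (armMean p e (0 : Fin (N + 1)) i))
      (fun _ => sum_bitWeight _) J fun β => discrimination (z *
        (bitWeight (p - e) β / bitWeight (p + e) β))
    simp only [episodeRatio_of_mem hJ hl, hl, if_true, mul_one]
    unfold rowWeight
    rw [h, (armMean_self hJ p e).2]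
    simpa [bitWeight] using discrimination_step (a := p - e) (b := p + e) hz (by linarith)
      (by linarith) h1
  · simp only [episodeRatio_of_notMem hl, hl, if_false, mul_one, mul_zero, add_zero,
      ← Finset.sum_mul, sum_rowWeight, one_mul]
    exact le_rfl

/-- The likelihood ratio of the completed episodes. -/
noncomputable def pastRatio (p e : ℝ) (J : Fin (N + 1))
    (x : Config (fun s => Fin (hardActions N s))) : ℝ :=
  (x.past.map (episodeRatio p e J)).prod

theorem episodeRatio_pos (hep : e < p) (he : 0 ≤ e) (h1 : p + e < 1) (J : Fin (N + 1))
    (l : List (Pair (fun s => Fin (hardActions N s)) × ℝ≥0)) : 0 < episodeRatio p e J l := by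
  rw [episodeRatio]
  split_ifs
  · exact div_pos (by linarith) (by linarith)
  · exact div_pos (by linarith) (by linarith)
  · exact one_pos

theorem pastRatio_pos (hep : e < p) (he : 0 ≤ e) (h1 : p + e < 1) (J : Fin (N + 1))
    (x : Config (fun s => Fin (hardActions N s))) : 0 < pastRatio p e J x := by
  refine List.prod_pos fun z hz => ?_
  obtain ⟨l, _, rfl⟩ := List.mem_map.mp hz
  exact episodeRatio_pos hep he h1 J l

theorem pastRatio_stepTo_some (J : Fin (N + 1)) (d : Pair (fun s => Fin (hardActions N s)) → ℝ≥0)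
    (x : Config (fun s => Fin (hardActions N s))) (a : Fin (hardActions N x.state)) (t) :
    pastRatio p e J (stepTo (hardMDP N D T) d x a (some t)) = pastRatio p e J x := rfl

theorem pastRatio_stepTo_none (J : Fin (N + 1)) (d : Pair (fun s => Fin (hardActions N s)) → ℝ≥0)
    (x : Config (fun s => Fin (hardActions N s))) (a : Fin (hardActions N x.state)) :
    pastRatio p e J (stepTo (hardMDP N D T) d x a none) =
      pastRatio p e J x * episodeRatio p e J (reveal d (x.cur ++ [⟨x.state, a⟩])) := by
  simp [pastRatio, stepTo, reveal]

/-- How often the arm `J` is chosen when it is the best one, in terms of the law for which arm `0`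
is the best one. -/
theorem meanValue_choose_eq {J : Fin (N + 1)} (hJ : J ≠ 0) (h0 : 0 < p + e) (h1 : p + e < 1)
    (n : ℕ) :
    meanValue (hardMDP N D T) L (hardCost p) K (rowWeight p e J) (fun _ x a => chooseGain J x a) n
        ⟨[], [], 0⟩ =
      meanValue (hardMDP N D T) L (hardCost p) K (rowWeight p e 0)
        (fun _ x a => pastRatio p e J x * chooseGain J x a) n ⟨[], [], 0⟩ := by
  have h := mul_meanValue_eq (M := hardMDP N D T) (L := L) (C := hardCost p) (K := K)
    (γ := chooseGain J) (Z := pastRatio p e J) (sum_rowWeight 0 (e := e) p)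
    (sum_rowWeight J (e := e) p) ?_ n ⟨[], [], 0⟩
  · rw [← h]
    simp [pastRatio]
  · intro x a o F
    cases o with
    | some t =>
      simp only [pastRatio_stepTo_some]
      simp only [stepTo, ← Finset.sum_mul, sum_rowWeight]
    | none =>
      simp only [pastRatio_stepTo_none, mul_assoc]
      have h2 := sum_rowWeight_reveal hJ h0 h1 (x.cur ++ [⟨x.state, a⟩]) fun l =>
        pastRatio p e J x * F ⟨x.past ++ [l], [], 0⟩
      refine h2.trans (Finset.sum_congr rfl fun r _ => ?_)
      simp only [stepTo, reveal, hardMDP]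
      ring

open Classical in
/-- Indicates that the arm `J` has been visited in the current episode. -/
noncomputable def visited (J : Fin (N + 1)) (x : Config (fun s => Fin (hardActions N s))) : ℝ :=
  if stayPair J ∈ x.cur ∨ x.state = arm J then 1 else 0

/-- The potential that pays for the difference between the two laws. -/
noncomputable def infoPotential (p e κ : ℝ) (K : ℕ) (J : Fin (N + 1))
    (x : Config (fun s => Fin (hardActions N s))) : ℝ :=
  if x.past.length < K then
    (((K : ℝ) - 1 - x.past.length) + if x.state = 0 then 1 else 0) *
      discrimination (pastRatio p e J x) + κ * visited J x
  else 0

theorem visited_le_one (J : Fin (N + 1)) (x : Config (fun s => Fin (hardActions N s))) :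
    visited J x ≤ 1 := by
  rw [visited]
  split_ifs <;> norm_num

theorem visited_nonneg (J : Fin (N + 1)) (x : Config (fun s => Fin (hardActions N s))) :
    0 ≤ visited J x := by
  rw [visited]
  split_ifs <;> norm_num

theorem visited_mono {J : Fin (N + 1)} {x y : Config (fun s => Fin (hardActions N s))}
    (h : stayPair J ∈ x.cur ∨ x.state = arm J → stayPair J ∈ y.cur ∨ y.state = arm J) :
    visited J x ≤ visited J y := by
  by_cases hx : stayPair J ∈ x.cur ∨ x.state = arm J
  · simp only [visited, hx, h hx, if_true, le_refl]
  · rw [visited, if_neg hx]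
    exact visited_nonneg J y

theorem infoPotential_nonneg (hep : e < p) (he : 0 ≤ e) (h1 : p + e < 1) {κ : ℝ} (hκ : 0 ≤ κ)
    (J : Fin (N + 1)) (x : Config (fun s => Fin (hardActions N s))) :
    0 ≤ infoPotential p e κ K J x := by
  rw [infoPotential]
  split_ifs with h h'
  all_goals first
    | exact le_rfl
    | have : (x.past.length : ℝ) + 1 ≤ K := by exact_mod_cast h
      exact add_nonneg (mul_nonneg (by linarith)
        (discrimination_nonneg (pastRatio_pos hep he h1 J x).le)) (mul_nonneg hκ (visited_nonneg J x))

/-- The chi-square divergence of the two laws of the bit of the best arm. -/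
noncomputable def chiSq (p e : ℝ) : ℝ := ((p + e) - (p - e)) ^ 2 / ((p + e) * (1 - (p + e)))

-- At the end of an episode the potential holds at most `K` copies of the discrimination. Each grows
-- on average by at most `4 * chiSq` if the bit of `J` was revealed, which explains the weight `4 *
-- chiSq p e * K` of `visited`.
open Classical in
theorem sum_infoPotential_none_le {J : Fin (N + 1)} (hJ : J ≠ 0) (hep : e < p) (he : 0 ≤ e)
    (h1 : p + e < 1) {x : Config (fun s => Fin (hardActions N s))}
    (a : Fin (hardActions N x.state)) (hx : x.past.length < K) :
    ∑ r, rowWeight p e 0 r * infoPotential p e (4 * chiSq p e * K) K J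
        (stepTo (hardMDP N D T) (hardCost p r) x a none) ≤
      ((K : ℝ) - 1 - x.past.length) * discrimination (pastRatio p e J x) +
        4 * chiSq p e * K * if stayPair J ∈ x.cur ++ [⟨x.state, a⟩] then 1 else 0 := by
  have hχ : 0 ≤ chiSq p e := by
    have : 0 ≤ (p : ℝ) := p.coe_nonneg
    exact div_nonneg (sq_nonneg _) (mul_nonneg (by linarith) (by linarith))
  have h2 : ∀ r, infoPotential p e (4 * chiSq p e * K) K J
      (stepTo (hardMDP N D T) (hardCost p r) x a none) = ((K : ℝ) - 1 - x.past.length) *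
        discrimination (pastRatio p e J x *
          episodeRatio p e J (reveal (hardCost p r) (x.cur ++ [⟨x.state, a⟩]))) := by
    intro r
    have hv : visited J (stepTo (hardMDP N D T) (hardCost p r) x a none) = 0 := by
      rw [visited, if_neg]
      simp only [stepTo, List.not_mem_nil, false_or, hardMDP]
      exact (arm_ne_zero J).symm
    rw [infoPotential, hv, pastRatio_stepTo_none]
    simp only [stepTo, List.length_append, List.length_singleton, hardMDP, if_true]
    split_ifs with h
    · push_cast
      ring
    · have : K = x.past.length + 1 := by omega
      rw [this]
      push_cast
      ring
  simp only [h2]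
  have h3 := sum_discrimination_le hJ he hep h1 (pastRatio_pos hep he h1 J x)
    (x.cur ++ [⟨x.state, a⟩])
  rw [mul_div_assoc, ← chiSq] at h3
  have hk : (0 : ℝ) ≤ (K : ℝ) - 1 - x.past.length := by
    have : (x.past.length : ℝ) + 1 ≤ K := by exact_mod_cast hx
    linarith
  have h4 := mul_le_mul_of_nonneg_left h3 hk
  rw [Finset.mul_sum] at h4
  simp only [mul_left_comm ((K : ℝ) - 1 - x.past.length)] at h4
  refine h4.trans ?_
  rw [mul_add]
  refine add_le_add_right ?_ _
  have h5 : ((K : ℝ) - 1 - x.past.length) ≤ K := by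
    linarith [(x.past.length).cast_nonneg (α := ℝ)]
  split_ifs
  · nlinarith
  · simp

theorem infoPotential_stepTo_some {κ : ℝ} (J : Fin (N + 1))
    (d : Pair (fun s => Fin (hardActions N s)) → ℝ≥0)
    {x : Config (fun s => Fin (hardActions N s))} (a : Fin (hardActions N x.state)) (t)
    (hx : x.past.length < K) :
    infoPotential p e κ K J (stepTo (hardMDP N D T) d x a (some t)) =
      (((K : ℝ) - 1 - x.past.length) + if t = 0 then 1 else 0) *
        discrimination (pastRatio p e J x) +
          κ * visited J ⟨x.past, x.cur ++ [⟨x.state, a⟩], t⟩ := by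
  rw [infoPotential, pastRatio_stepTo_some]
  exact if_pos hx

/-- The discrimination is multiplied by the number of arm choices still to come. A choice of `J`
releases one copy, which pays for the likelihood ratio through `le_discrimination`; the constant
subtracted from the gain pays for `5/3` and for the weight of `visited`. That weight in turn pays
for the growth of the remaining copies when the bit is revealed. -/
theorem bellman_infoPotential {J : Fin (N + 1)} (hJ : J ≠ 0) (hD : 1 ≤ D) (hT : 1 ≤ T)
    (hep : e < p) (he : 0 ≤ e) (h1 : p + e < 1) {x : Config (fun s => Fin (hardActions N s))}
    (hx : x.past.length < K) (a : Fin (hardActions N x.state)) :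
    bellman (hardMDP N D T) (hardCost p) (rowWeight p e 0)
        (fun _ x a => pastRatio p e J x * chooseGain J x a -
          (5 / 3 + 4 / 3 * (4 * chiSq p e * K)) * chooseGain J x a)
        (fun x => 4 / 3 * infoPotential p e (4 * chiSq p e * K) K J x) x a ≤
      4 / 3 * infoPotential p e (4 * chiSq p e * K) K J x := by
  classical
  have hχ : 0 ≤ chiSq p e := by
    have : 0 ≤ (p : ℝ) := p.coe_nonneg
    exact div_nonneg (sq_nonneg _) (mul_nonneg (by linarith) (by linarith))
  have hnone := sum_infoPotential_none_le (D := D) (T := T) hJ hep he h1 a hx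
  set κ : ℝ := 4 * chiSq p e * K
  have hκ : 0 ≤ κ := by positivity
  have hsum := sum_rowWeight (0 : Fin (N + 1)) (e := e) p
  have hz := pastRatio_pos hep he h1 J x
  have hg := discrimination_nonneg hz.le
  have hzg := le_discrimination hz.le
  -- a step that leads to the goal with probability `1 / t` and back to the same state otherwise
  have hgeo : ∀ t : ℝ, 1 ≤ t → x.state ≠ 0 →
      (hardMDP N D T).P x.state a = geometricStep x.state t →
      (stayPair J = ⟨x.state, a⟩ → x.state = arm J) →
      bellman (hardMDP N D T) (hardCost p) (rowWeight p e 0)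
        (fun _ x a => pastRatio p e J x * chooseGain J x a -
          (5 / 3 + 4 / 3 * κ) * chooseGain J x a)
        (fun x => 4 / 3 * infoPotential p e κ K J x) x a ≤ 4 / 3 * infoPotential p e κ K J x := by
    intro t ht hs hP hv
    have hsome : ∀ r, infoPotential p e κ K J (stepTo (hardMDP N D T) (hardCost p r) x a
        (some x.state)) ≤ infoPotential p e κ K J x := by
      intro r
      rw [infoPotential_stepTo_some J _ a _ hx, infoPotential, if_pos hx]
      refine add_le_add_right (mul_le_mul_of_nonneg_left (visited_mono ?_) hκ) _
      rintro (h | h)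
      · rw [List.mem_append, List.mem_singleton] at h
        exact h.imp id hv
      · exact Or.inr h
    have hnone' : ∑ r, rowWeight p e 0 r * infoPotential p e κ K J
        (stepTo (hardMDP N D T) (hardCost p r) x a none) ≤ infoPotential p e κ K J x := by
      refine hnone.trans ?_
      rw [infoPotential, if_pos hx, if_neg hs, add_zero]
      refine add_le_add_right (mul_le_mul_of_nonneg_left ?_ hκ) _
      rw [visited]
      by_cases h : stayPair J ∈ x.cur ++ [⟨x.state, a⟩]
      · have h' : stayPair J ∈ x.cur ∨ x.state = arm J := by
          rw [List.mem_append, List.mem_singleton] at h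
          exact h.imp id hv
        rw [if_pos h, if_pos h']
      · rw [if_neg h]
        split_ifs <;> norm_num
    simp only [bellman, chooseGain_of_ne J x a hs, mul_zero, sub_zero, zero_add,
      meanNext_of_geometricStep _ ht hP]
    have ht1 : t⁻¹ ≤ 1 := inv_le_one_of_one_le₀ ht
    have ht0 : 0 ≤ t⁻¹ := by positivity
    -- A step that does not end the episode reveals nothing, so the row there is irrelevant and the
    -- constant row `true` stands in for all rows.
    have e1 : ∀ r, rowWeight p e 0 r * (t⁻¹ * (4 / 3 * infoPotential p e κ K J
          (stepTo (hardMDP N D T) (hardCost p r) x a none)) + (1 - t⁻¹) * (4 / 3 *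
            infoPotential p e κ K J
              (stepTo (hardMDP N D T) (hardCost p r) x a (some x.state)))) =
        t⁻¹ * (4 / 3) * (rowWeight p e 0 r * infoPotential p e κ K J
          (stepTo (hardMDP N D T) (hardCost p r) x a none)) +
        rowWeight p e 0 r * ((1 - t⁻¹) * (4 / 3 * infoPotential p e κ K J
          (stepTo (hardMDP N D T) (hardCost p (fun _ => true)) x a (some x.state)))) := by
      intro r
      have : stepTo (hardMDP N D T) (hardCost p r) x a (some x.state) =
        stepTo (hardMDP N D T) (hardCost p (fun _ => true)) x a (some x.state) := rfl
      rw [this]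
      ring
    simp only [e1, Finset.sum_add_distrib, ← Finset.mul_sum, ← Finset.sum_mul, hsum, one_mul]
    nlinarith [mul_le_mul_of_nonneg_left hnone' ht0,
      mul_le_mul_of_nonneg_left (hsome fun _ => true) (sub_nonneg.mpr ht1)]
  -- a deterministic step that does not lead to the initial state
  have hpure : ∀ t, t ≠ 0 → (hardMDP N D T).P x.state a = PMF.pure (some t) →
      visited J ⟨x.past, x.cur ++ [⟨x.state, a⟩], t⟩ ≤ visited J x + chooseGain J x a →
      bellman (hardMDP N D T) (hardCost p) (rowWeight p e 0)
        (fun _ x a => pastRatio p e J x * chooseGain J x a -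
          (5 / 3 + 4 / 3 * κ) * chooseGain J x a)
        (fun x => 4 / 3 * infoPotential p e κ K J x) x a ≤ 4 / 3 * infoPotential p e κ K J x := by
    intro t ht hP hv
    simp only [bellman, meanNext_of_pure _ hP, infoPotential_stepTo_some J _ a _ hx, if_neg ht,
      ← Finset.sum_mul, hsum, one_mul]
    rw [infoPotential, if_pos hx]
    have hv' := mul_le_mul_of_nonneg_left hv hκ
    by_cases h : x.state = 0 ∧ a.val = J.val
    · have hc : chooseGain J x a = 1 := if_pos h
      rw [hc] at hv' ⊢
      rw [if_pos h.1]
      linarith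
    · have hc : chooseGain J x a = 0 := if_neg h
      rw [hc] at hv' ⊢
      split_ifs <;> linarith
  induction x, a using config_cases with
  | choose past cur i =>
    refine hpure (arm i) (arm_ne_zero i) (step_choose i) ?_
    by_cases hi : i = J
    · have hc : chooseGain J ⟨past, cur, 0⟩ (choosePair i).2 = 1 := by
        rw [chooseGain_choose, if_pos hi]
      refine (visited_le_one _ _).trans (hc.ge.trans (le_add_of_nonneg_left (visited_nonneg _ _)))
    · refine le_add_of_le_of_nonneg (visited_mono ?_) (chooseGain_nonneg _ _ _)
      rintro (h | h)
      · refine (List.mem_append.mp h).imp id fun h' => ?_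
        exact absurd (congrArg Sigma.fst (List.mem_singleton.mp h')) (arm_ne_zero J)
      · exact absurd (arm_injective h) hi
  | fast past cur =>
    refine hgeo D hD (by simp) step_fast fun h => ?_
    exact absurd (congrArg Sigma.fst h).symm (one_ne_arm J)
  | stay past cur i =>
    refine hgeo T hT (arm_ne_zero i) (step_stay i) fun h => ?_
    exact (congrArg Sigma.fst h).symm
  | leave past cur i =>
    refine hpure 1 (by simp) (step_leave i) ?_
    refine le_add_of_le_of_nonneg (visited_mono ?_) (chooseGain_nonneg _ _ _)
    rintro (h | h)
    · refine (List.mem_append.mp h).imp id fun h' => ?_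
      exact (congrArg Sigma.fst (List.mem_singleton.mp h')).symm
    · exact absurd h (one_ne_arm J)

/-- How often the arm `J` is chosen when it is the best one, against how often it is chosen when
the arm `0` is the best one. -/
theorem meanValue_choose_le (hD : 1 ≤ D) (hT : 1 ≤ T) (hep : e < p) (he : 0 ≤ e)
    (h1 : p + e < 1) (J : Fin (N + 1)) (n : ℕ) :
    meanValue (hardMDP N D T) L (hardCost p) K (rowWeight p e J) (fun _ x a => chooseGain J x a) n
        ⟨[], [], 0⟩ ≤
      (5 / 3 + 4 / 3 * (4 * chiSq p e * K)) *
        meanValue (hardMDP N D T) L (hardCost p) K (rowWeight p e 0)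
          (fun _ x a => chooseGain J x a) n ⟨[], [], 0⟩ := by
  have hp : 0 ≤ (p : ℝ) := p.coe_nonneg
  have hχ : 0 ≤ chiSq p e :=
    div_nonneg (sq_nonneg _) (mul_nonneg (by linarith) (by linarith))
  have hν : ∀ r, 0 ≤ rowWeight p e (0 : Fin (N + 1)) r := by
    refine fun r => Finset.prod_nonneg fun i _ => ?_
    rw [bitWeight, armMean]
    split_ifs <;> linarith
  by_cases hJ : J = 0
  · subst hJ
    refine le_mul_of_one_le_left (meanValue_nonneg hν (fun _ x a => chooseGain_nonneg 0 x a) n _) ?_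
    have : 0 ≤ 4 / 3 * (4 * chiSq p e * K) := by positivity
    linarith
  · rw [meanValue_choose_eq hJ (by linarith) h1]
    have h := meanValue_le_potential (M := hardMDP N D T) (L := L) (C := hardCost p) (K := K) hν
      (fun x => mul_nonneg (by norm_num : (0 : ℝ) ≤ 4 / 3)
        (infoPotential_nonneg (κ := 4 * chiSq p e * K) hep he h1 (by positivity) J x))
      (fun x hx a => bellman_infoPotential hJ hD hT hep he h1 hx a) n ⟨[], [], 0⟩
    -- With an empty past the ratio is `1`, where the discrimination vanishes, and no arm has been
    -- visited. The bound therefore has no additive term.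
    have h0 : infoPotential p e (4 * chiSq p e * K) K J ⟨[], [], 0⟩ = 0 := by
      have hv : visited J ⟨[], [], 0⟩ = 0 := by
        rw [visited, if_neg]
        simp [(arm_ne_zero J).symm]
      simp [infoPotential, hv, pastRatio, discrimination]
    simp only [h0, mul_zero, sub_eq_add_neg, ← neg_mul] at h
    rw [meanValue_add, meanValue_mul] at h
    linarith

end Information

/-! ### Policies of the hard instance: diameter and optimal hitting time. -/

section HardPolicies

variable {N K : ℕ} {D T : ℝ} {p : ℝ≥0}

/-- The policy that chooses the arm `i` and plays the action `β` in the states of the arms. -/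
def armPolicy (i : Fin (N + 1)) (β : Fin 2) : Policy (fun s => Fin (hardActions N s)) :=
  Fin.cases (motive := fun s => Fin (hardActions N s)) i
    (Fin.cases (motive := fun s => Fin (hardActions N s.succ)) (0 : Fin 1) fun _ => β)

variable (c : Pair (fun s => Fin (hardActions N s)) → ℝ≥0)
  (π : Policy (fun s => Fin (hardActions N s)))

theorem costToGo_fast (hD : 1 ≤ D) :
    (hardMDP N D T).costToGo c π 1 = ENNReal.ofReal D * c (fastPair N) := by
  rw [costToGo_of_geometricStep _ π c hD rfl]
  have h : π 1 = (fastPair N).2 := Subsingleton.elim (α := Fin 1) _ _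
  rw [h]
  rfl

theorem costToGo_stay (hT : 1 ≤ T) {i : Fin (N + 1)} (h : π (arm i) = (stayPair i).2) :
    (hardMDP N D T).costToGo c π (arm i) = ENNReal.ofReal T * c (stayPair i) := by
  rw [costToGo_of_geometricStep _ π c hT (by rw [h]; exact step_stay i), h]
  rfl

theorem costToGo_leave (hD : 1 ≤ D) {i : Fin (N + 1)} (h : π (arm i) = (leavePair i).2) :
    (hardMDP N D T).costToGo c π (arm i) =
      c (leavePair i) + ENNReal.ofReal D * c (fastPair N) := by
  rw [costToGo_of_pure _ π c (by rw [h]; exact step_leave i), costToGo_fast c π hD, h]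
  rfl

theorem costToGo_choose {i : Fin (N + 1)} (h : π 0 = (choosePair i).2) :
    (hardMDP N D T).costToGo c π 0 = c (choosePair i) + (hardMDP N D T).costToGo c π (arm i) := by
  rw [costToGo_of_pure _ π c (by rw [h]; exact step_choose i), h]
  rfl

theorem stay_or_leave (i : Fin (N + 1)) :
    π (arm i) = (stayPair i).2 ∨ π (arm i) = (leavePair i).2 := by
  have h : ∀ a : Fin 2, a = 0 ∨ a = 1 := by decide
  exact h (π (arm i))

theorem hittingTime_fast (hD : 1 ≤ D) :
    (hardMDP N D T).hittingTime π 1 = ENNReal.ofReal D := by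
  rw [hittingTime_eq_costToGo, costToGo_fast _ π hD]
  simp

theorem hittingTime_stay (hT : 1 ≤ T) {i : Fin (N + 1)} (h : π (arm i) = (stayPair i).2) :
    (hardMDP N D T).hittingTime π (arm i) = ENNReal.ofReal T := by
  rw [hittingTime_eq_costToGo, costToGo_stay _ π hT h]
  simp

theorem hittingTime_leave (hD : 1 ≤ D) {i : Fin (N + 1)} (h : π (arm i) = (leavePair i).2) :
    (hardMDP N D T).hittingTime π (arm i) = ENNReal.ofReal (D + 1) := by
  rw [hittingTime_eq_costToGo, costToGo_leave _ π hD h,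
    ENNReal.ofReal_add (by linarith) zero_le_one]
  simp [add_comm]

theorem hittingTime_choose {i : Fin (N + 1)} (h : π 0 = (choosePair i).2) :
    (hardMDP N D T).hittingTime π 0 = 1 + (hardMDP N D T).hittingTime π (arm i) := by
  rw [hittingTime_eq_costToGo, costToGo_choose _ π h, hittingTime_eq_costToGo]
  simp

theorem isProper_hardMDP (hD : 1 ≤ D) (hT : 1 ≤ T) : (hardMDP N D T).IsProper π := by
  have harm : ∀ i, (hardMDP N D T).hittingTime π (arm i) ≠ ⊤ := by
    intro i
    rcases stay_or_leave π i with h | h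
    · rw [hittingTime_stay π hT h]
      exact ENNReal.ofReal_ne_top
    · rw [hittingTime_leave π hD h]
      exact ENNReal.ofReal_ne_top
  refine isProper_of_hittingTime_ne_top _ _ (stateFun_cases ?_ ?_ harm)
  · rw [hittingTime_choose π (i := π 0) rfl]
    exact ENNReal.add_ne_top.mpr ⟨ENNReal.one_ne_top, harm _⟩
  · rw [hittingTime_fast π hD]
    exact ENNReal.ofReal_ne_top

theorem one_add_ofReal {z : ℝ} (hz : 0 ≤ z) :
    1 + ENNReal.ofReal z = ENNReal.ofReal (z + 1) := by
  rw [ENNReal.ofReal_add hz zero_le_one, ENNReal.ofReal_one, add_comm]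

/-- The initial state is the farthest one. The fastest way from it is to enter an arm and leave at
once, since `D + 1 ≤ T` makes staying no faster. -/
theorem diameter_hardMDP (hD : 1 ≤ D) (hT : D + 1 ≤ T) :
    (hardMDP N D T).diameter = ENNReal.ofReal (D + 2) := by
  have hT1 : 1 ≤ T := by linarith
  have h2 : D + 2 = (D + 1) + 1 := by ring
  apply le_antisymm
  · refine iSup_le fun s => (iInf₂_le (armPolicy 0 1) (isProper_hardMDP _ hD hT1)).trans ?_
    have hleave : ∀ i, (hardMDP N D T).hittingTime (armPolicy 0 1) (arm i) =
        ENNReal.ofReal (D + 1) := fun i => hittingTime_leave _ hD rfl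
    revert s
    refine stateFun_cases ?_ ?_ ?_
    · rw [hittingTime_choose (armPolicy 0 1) (i := 0) rfl, hleave, one_add_ofReal (by linarith), h2]
    · rw [hittingTime_fast _ hD]
      exact ENNReal.ofReal_le_ofReal (by linarith)
    · intro i
      rw [hleave]
      exact ENNReal.ofReal_le_ofReal (by linarith)
  · refine le_trans (le_iInf₂ fun π _ => ?_)
      (le_iSup (fun s => ⨅ π, ⨅ _ : (hardMDP N D T).IsProper π, (hardMDP N D T).hittingTime π s) 0)
    rw [hittingTime_choose π (i := π 0) rfl]
    rcases stay_or_leave π (π 0) with h | h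
    · rw [hittingTime_stay π hT1 h, one_add_ofReal (by linarith)]
      exact ENNReal.ofReal_le_ofReal (by linarith)
    · rw [hittingTime_leave π hD h, one_add_ofReal (by linarith), h2]

theorem totalCostToGo_stay (hT : 1 ≤ T) (b : Fin K → Fin (N + 1) → Bool) (J : Fin (N + 1)) :
    (hardMDP N D T).totalCostToGo (fun k => hardCost p (b k)) (armPolicy J 0) =
      ENNReal.ofReal (T * ∑ k, (hardCost p (b k) (stayPair J) : ℝ)) := by
  rw [Finset.mul_sum, ENNReal.ofReal_sum_of_nonneg fun k _ => by positivity]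
  refine Finset.sum_congr rfl fun k _ => ?_
  change (hardMDP N D T).costToGo (hardCost p (b k)) (armPolicy J 0) 0 = _
  rw [costToGo_choose _ (armPolicy J 0) (i := J) rfl, costToGo_stay _ (armPolicy J 0) hT rfl,
    hardCost_choose, ENNReal.ofReal_mul (by linarith), ENNReal.ofReal_coe_nnreal]
  simp

theorem totalCostToGo_leave (hD : 1 ≤ D) (b : Fin K → Fin (N + 1) → Bool)
    {i : Fin (N + 1)} (hi : π 0 = (choosePair i).2) (h : π (arm i) = (leavePair i).2) :
    (hardMDP N D T).totalCostToGo (fun k => hardCost p (b k)) π =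
      ENNReal.ofReal (K * (D + 1)) := by
  have h1 : ∀ k, (hardMDP N D T).costToGo (hardCost p (b k)) π (hardMDP N D T).init =
      ENNReal.ofReal (D + 1) := by
    intro k
    change (hardMDP N D T).costToGo (hardCost p (b k)) π 0 = _
    rw [costToGo_choose _ π hi, costToGo_leave _ π hD h, hardCost_choose,
      hardCost_fast, hardCost_leave, ← one_add_ofReal (by linarith)]
    simp
  simp only [MDP.totalCostToGo, h1, Finset.sum_const, Finset.card_univ, Fintype.card_fin,
    nsmul_eq_mul]
  rw [ENNReal.ofReal_mul (by positivity), ENNReal.ofReal_natCast]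

/-- The optimal policies stay in an arm, since always staying in the arm `0` is better than to
leave. -/
theorem hittingTime_of_isOptimal (hD : 1 ≤ D) (hT : D + 1 ≤ T) (hK : 0 < K)
    (hpT : p * T = D / 4) (b : Fin K → Fin (N + 1) → Bool)
    (hπ : (hardMDP N D T).IsOptimal (fun k => hardCost p (b k)) π) :
    (hardMDP N D T).hittingTime π (hardMDP N D T).init = ENNReal.ofReal (T + 1) := by
  have hT1 : 1 ≤ T := by linarith
  change (hardMDP N D T).hittingTime π 0 = _
  rcases stay_or_leave π (π 0) with h | h
  · rw [hittingTime_choose π (i := π 0) rfl, hittingTime_stay π hT1 h, one_add_ofReal (by linarith)]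
  · exfalso
    have h1 := hπ.2 (armPolicy 0 0) (isProper_hardMDP _ hD hT1)
    have hK' : (0 : ℝ) < K := by exact_mod_cast hK
    -- The cost of arm `0` is deterministic, so this comparison holds for every realization of the
    -- bits and not just on average.
    have h2 : T * ∑ k : Fin K, (hardCost p (b k) (stayPair 0) : ℝ) = K * (D / 4) := by
      simp only [hardCost_stay, if_true, Finset.sum_const, Finset.card_univ, Fintype.card_fin,
        nsmul_eq_mul]
      rw [← hpT]
      ring
    rw [totalCostToGo_leave π hD b (i := π 0) rfl h, totalCostToGo_stay hT1, h2,
      ENNReal.ofReal_le_ofReal_iff (by positivity)] at h1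
    have := le_of_mul_le_mul_left h1 hK'
    linarith

theorem sum_hardActions : ∑ s, (Fintype.card (Fin (hardActions N s)) : ℝ) = 3 * N + 4 := by
  rw [Fin.sum_univ_succ, Fin.sum_univ_succ]
  simp only [Fintype.card_fin]
  have h0 : hardActions N 0 = N + 1 := rfl
  have h1 : hardActions N (Fin.succ 0) = 1 := rfl
  have h2 : ∀ i : Fin (N + 1), hardActions N i.succ.succ = 2 := fun _ => rfl
  simp only [h0, h1, h2, Finset.sum_const, Finset.card_univ, Fintype.card_fin, nsmul_eq_mul]
  push_cast
  ring

end HardPolicies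

/-! ### Averaging over the best arm and over the bits. -/

section Main

variable {N K : ℕ} {D T e : ℝ} {p : ℝ≥0}

theorem sum_rowWeight_stay_total (e : ℝ) (J : Fin (N + 1)) :
    ∑ b : Fin K → Fin (N + 1) → Bool, (∏ k, rowWeight p e J (b k)) *
      ∑ k, (hardCost p (b k) (stayPair J) : ℝ) = K * armMean p e J J := by
  simp only [Finset.mul_sum]
  rw [Finset.sum_comm]
  have h : ∀ k : Fin K, ∑ b : Fin K → Fin (N + 1) → Bool, (∏ k, rowWeight p e J (b k)) *
      (hardCost p (b k) (stayPair J) : ℝ) = armMean p e J J := by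
    intro k
    rw [sum_prod_mul_coord (fun _ => rowWeight p e J) (fun _ => sum_rowWeight J p) k
      fun r => (hardCost p r (stayPair J) : ℝ), sum_rowWeight_mul_stay]
  simp [h]

/-- For some best arm and some bits, the learner loses against staying in the best arm. -/
theorem exists_large_regret (L : Learner (fun s => Fin (hardActions N s))) (hN : 1 ≤ N)
    (hD : 1 ≤ D) (hT : D + 1 ≤ T) (he : 0 < e) (hep : e ≤ p / 2) (hpT : p * T = D / 4)
    (hp4 : (p : ℝ) ≤ 1 / 4) (hK : 0 < K) (heK : 576 * K * e ^ 2 ≤ p * (N + 1)) :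
    ∃ (n : ℕ) (J : Fin (N + 1)) (b : Fin K → Fin (N + 1) → Bool),
      e * T * K / 30 ≤ fixedValue (hardMDP N D T) L (hardCost p) b (costGain (hardCost p)) n
        ⟨[], [], 0⟩ - T * ∑ k, (hardCost p (b k) (stayPair J) : ℝ) := by
  have hT1 : 1 ≤ T := by linarith
  have hT0 : 0 < T := by linarith
  have hK' : (0 : ℝ) < K := by exact_mod_cast hK
  have hN' : (1 : ℝ) ≤ N := by exact_mod_cast hN
  have hp : (0 : ℝ) < p := by linarith
  have hX : 0 < e * T * K / 30 := by positivity
  set X := e * T * K / 30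
  set B : ℝ := (K * (D + T) + (D + T)) * (K * (1 + T))
  -- The truncation error `B / n` of `cost_lower_bound` drops below `X`. As `B` depends neither on
  -- `J` nor on the bits, one horizon serves all instances.
  obtain ⟨n, hn⟩ := exists_nat_gt (B / X)
  have hB : 0 < B := by positivity
  have hn0 : (0 : ℝ) < n := lt_trans (by positivity) hn
  have hnB : B ≤ n * X := by
    rw [div_lt_iff₀ hX] at hn
    exact hn.le
  by_contra! hcon
  set W : Fin (N + 1) → ℝ := fun J => meanValue (hardMDP N D T) L (hardCost p) K
    (rowWeight p e J) (costGain (hardCost p)) n ⟨[], [], 0⟩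
  set R : Fin (N + 1) → ℝ := fun J => meanValue (hardMDP N D T) L (hardCost p) K
    (rowWeight p e J) (fun _ x a => chooseGain J x a) n ⟨[], [], 0⟩
  set Q : Fin (N + 1) → ℝ := fun J => meanValue (hardMDP N D T) L (hardCost p) K
    (rowWeight p e 0) (fun _ x a => chooseGain J x a) n ⟨[], [], 0⟩
  -- Average the assumed upper bounds over independent rows of instance `J`.
  have h1 : ∀ J, W J - T * (K * armMean p e J J) ≤ X := by
    intro J
    have hw : ∀ b : Fin K → Fin (N + 1) → Bool, 0 ≤ ∏ k, rowWeight p e J (b k) :=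
      fun b => Finset.prod_nonneg fun k _ => rowWeight_nonneg J he.le hep hp4 _
    have hsum : ∑ b : Fin K → Fin (N + 1) → Bool, ∏ k, rowWeight p e J (b k) = 1 :=
      sum_prod_eq_one (fun _ => rowWeight p e J) fun _ => sum_rowWeight J p
    have h2 := Finset.sum_le_sum fun (b : Fin K → Fin (N + 1) → Bool) (_ : b ∈ Finset.univ) =>
      mul_le_mul_of_nonneg_left (hcon n J b).le (hw b)
    simp only [mul_sub, Finset.sum_sub_distrib, mul_left_comm _ T, ← Finset.mul_sum,
      sum_rowWeight_stay_total, ← Finset.sum_mul, hsum, one_mul] at h2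
    rw [sum_fixedValue _ _ _ _ (sum_rowWeight J p)] at h2
    exact h2
  have h2 : ∀ J, K * (e * T) ≤ 2 * X + e * T * R J := by
    intro J
    have h3 := cost_lower_bound (L := L) hD hT he.le hep hpT hp4 hK J n
    have h4 : (n : ℝ) * (K * ((armMean p e J J + e) * T)) ≤ n * (W J + e * T * R J + X) := by
      refine h3.trans ?_
      rw [mul_add (n : ℝ) _ X]
      exact add_le_add le_rfl hnB
    have h5 := le_of_mul_le_mul_left h4 hn0
    have := h1 J
    linarith
  -- Here `chiSq` is `4 e ^ 2` over a denominator of at least `5p/8`, because `p + e ≤ 3/8`; then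
  -- `576 K e ^ 2 ≤ p (N + 1)` suffices.
  have hχ : 4 * chiSq p e * K ≤ (N + 1) / 16 := by
    have hden : 0 < ((p : ℝ) + e) * (1 - (p + e)) := mul_pos (by linarith) (by linarith)
    have h3 : 5 / 8 * (p : ℝ) ≤ (p + e) * (1 - (p + e)) := by nlinarith
    rw [chiSq, mul_div_assoc', div_mul_eq_mul_div, div_le_iff₀ hden]
    have h4 : ((N : ℝ) + 1) / 16 * (5 / 8 * p) ≤
        (N + 1) / 16 * ((p + e) * (1 - (p + e))) :=
      mul_le_mul_of_nonneg_left h3 (by positivity)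
    nlinarith
  have h3 : ∑ J, R J ≤ 11 / 12 * (N + 1) * K := by
    have hQ : ∑ J, Q J ≤ K := sum_choose_le hD hT hK (rowWeight_nonneg 0 he.le hep hp4)
      (sum_rowWeight 0 p) n
    -- The left side is at most `5/3 + (N + 1) / 12`, and `5/3 ≤ 10/12 (N + 1)` needs two arms, that
    -- is `S ≥ 4`.
    have hl : 5 / 3 + 4 / 3 * (4 * chiSq p e * K) ≤ 11 / 12 * ((N : ℝ) + 1) := by linarith
    have hQ0 : ∀ J, 0 ≤ Q J := fun J => meanValue_nonneg (rowWeight_nonneg 0 he.le hep hp4)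
      (fun _ x a => chooseGain_nonneg J x a) n _
    calc ∑ J, R J ≤ ∑ J, 11 / 12 * ((N : ℝ) + 1) * Q J := by
          refine Finset.sum_le_sum fun J _ => ?_
          exact (meanValue_choose_le hD hT1 (by linarith) he.le (by linarith) J n).trans
            (mul_le_mul_of_nonneg_right hl (hQ0 J))
      _ = 11 / 12 * ((N : ℝ) + 1) * ∑ J, Q J := by rw [Finset.mul_sum]
      _ ≤ _ := mul_le_mul_of_nonneg_left hQ (by positivity)
  -- Per arm, the sum over `J` would give `e T K ≤ 2 X + 11/12 e T K`. This is absurd, as `2 X` is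
  -- `e T K / 15`, less than `e T K / 12`.
  have h4 := Finset.sum_le_sum fun J (_ : J ∈ (Finset.univ : Finset (Fin (N + 1)))) => h2 J
  simp only [Finset.sum_add_distrib, ← Finset.mul_sum, Finset.sum_const, Finset.card_univ,
    Fintype.card_fin, nsmul_eq_mul] at h4
  push_cast at h4
  have h5 : e * T * ∑ J, R J ≤ e * T * (11 / 12 * (N + 1) * K) :=
    mul_le_mul_of_nonneg_left h3 (by positivity)
  have h6 : X = e * T * K / 30 := rfl
  have h7 : 0 < (N + 1) * (e * T * K) := by positivity
  rw [h6] at h4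
  nlinarith

end Main

end SSP

/-! ### Choice of the parameters and conclusion. -/

theorem mainTheorem5 :
    ∃ C : ℝ, 0 < C ∧
      ∀ (S K : ℕ) (D Tstar : ℝ), 4 ≤ S → 1 ≤ D → D + 1 ≤ Tstar →
        (S : ℝ) * Tstar ≤ 16 * D * (K : ℝ) →
        ∃ (numActions : Fin S → ℕ) (M : SSP.MDP (Fin S) (fun s => Fin (numActions s))),
          (∃ π, M.IsProper π) ∧
          M.diameter = ENNReal.ofReal (D + 2) ∧
          ∀ L : SSP.Learner (fun s => Fin (numActions s)),
            ∃ c : SSP.Costs (fun s => Fin (numActions s)) K,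
              SSP.IsCost c ∧
              (∀ π, M.IsOptimal c π → M.hittingTime π M.init = ENNReal.ofReal (Tstar + 1)) ∧
              ((C * √(D * Tstar * (S : ℝ) * SSP.avgActions (fun s => Fin (numActions s)) * (K : ℝ)) :
                  ℝ) : EReal) ≤ SSP.expectedRegret M c L := by
  -- `2880 = 30 * 96`: the regret is at least `e T K / 30`, and the square root is at most `96 e T
  -- K`.
  refine ⟨1 / 2880, by norm_num, ?_⟩
  intro S K D T hS hD hT hSK
  obtain ⟨N, rfl⟩ : ∃ N, S = N + 3 := ⟨S - 3, by omega⟩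
  have hN : 1 ≤ N := by omega
  have hT1 : 1 ≤ T := by linarith
  have hT0 : 0 < T := by linarith
  have hD0 : 0 < D := by linarith
  push_cast at hSK
  have hK' : (0 : ℝ) < K := by
    by_contra h
    have h1 : 16 * D * (K : ℝ) ≤ 0 := mul_nonpos_of_nonneg_of_nonpos (by positivity) (not_lt.mp h)
    have h2 : 0 < ((N : ℝ) + 3) * T := by positivity
    linarith
  have hK : 0 < K := by exact_mod_cast hK'
  have hp0 : 0 < D / (4 * T) := by positivity
  obtain ⟨p, hp⟩ : ∃ p : ℝ≥0, (p : ℝ) = D / (4 * T) := ⟨⟨_, hp0.le⟩, rfl⟩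
  have hpT : p * T = D / 4 := by rw [hp]; field_simp
  have hp4 : (p : ℝ) ≤ 1 / 4 := by
    rw [hp, div_le_div_iff₀ (by positivity) (by norm_num)]
    linarith
  have hp' : (0 : ℝ) < p := hp ▸ hp0
  set e : ℝ := √(p * (N + 1) / K) / 24
  have he : 0 < e := by positivity
  have he2 : e ^ 2 = p * (N + 1) / K / 576 := by
    rw [div_pow, Real.sq_sqrt (by positivity)]
    norm_num
  -- Squared, this says `(N + 1) T ≤ 36 D K`, which follows from `S T ≤ 16 D K`.
  have hep : e ≤ p / 2 := by
    refine le_of_sq_le_sq ?_ (by positivity)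
    rw [he2, div_div, div_le_iff₀ (by positivity)]
    have h1 : ((N : ℝ) + 1) * T ≤ 144 * K * (p * T) := by
      rw [hpT]
      nlinarith
    have h2 : (N : ℝ) + 1 ≤ 144 * K * p := by
      refine le_of_mul_le_mul_right ?_ hT0
      linarith
    nlinarith
  refine ⟨SSP.hardActions N, SSP.hardMDP N D T, ⟨SSP.armPolicy 0 0, SSP.isProper_hardMDP _ hD hT1⟩,
    SSP.diameter_hardMDP hD hT, fun L => ?_⟩
  obtain ⟨n, J, b, hreg⟩ := SSP.exists_large_regret L hN hD hT he hep hpT hp4 hK (by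
    rw [he2]
    have : 576 * (K : ℝ) * (p * (N + 1) / K / 576) = p * (N + 1) := by field_simp
    exact this.le)
  refine ⟨fun k => SSP.hardCost p (b k), fun k y => SSP.hardCost_le_one ?_ y,
    fun π hπ => SSP.hittingTime_of_isOptimal π hD hT hK hpT b hπ, ?_⟩
  · have : (p : ℝ) ≤ 1 := by linarith
    exact_mod_cast this
  · set W := SSP.fixedValue (SSP.hardMDP N D T) L (SSP.hardCost p) b
      (SSP.costGain (SSP.hardCost p)) n ⟨[], [], 0⟩
    set y := T * ∑ k, (SSP.hardCost p (b k) (SSP.stayPair J) : ℝ)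
    have hy : 0 ≤ y := by positivity
    have hbound : 1 / 2880 * √(D * T * ((N + 3 : ℕ) : ℝ) *
        SSP.avgActions (fun s => Fin (SSP.hardActions N s)) * (K : ℝ)) ≤ W - y := by
      refine le_trans ?_ hreg
      have h1 : D * T * ((N + 3 : ℕ) : ℝ) * SSP.avgActions (fun s => Fin (SSP.hardActions N s)) *
          (K : ℝ) = D * T * (3 * N + 4) * K := by
        rw [SSP.avgActions, SSP.sum_hardActions, Fintype.card_fin]
        have : ((N + 3 : ℕ) : ℝ) ≠ 0 := by positivity
        field_simp
      -- The square of the right side equals `4 (N + 1) D T K`.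
      have h2 : √(D * T * (3 * N + 4) * K) ≤ 96 * (e * T * K) := by
        refine Real.sqrt_le_iff.mpr ⟨by positivity, ?_⟩
        have h3 : (96 * (e * T * K)) ^ 2 = 16 * ((p * T) * (N + 1)) * T * K := by
          rw [show (96 * (e * T * K)) ^ 2 = 9216 * e ^ 2 * T ^ 2 * K ^ 2 by ring, he2]
          field_simp
          norm_num
        rw [h3, hpT]
        have h4 : 0 ≤ D * T * K * N := by positivity
        nlinarith
      rw [h1]
      linarith
    have hcost : ((W : ℝ) : EReal) ≤ (SSP.learnerCost (SSP.hardMDP N D T)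
        (fun k => SSP.hardCost p (b k)) L : EReal) := by
      refine le_trans ?_ (EReal.coe_ennreal_le_coe_ennreal_iff.mpr
        (SSP.ofReal_fixedValue_le_learnerCost (SSP.hardMDP N D T) L (SSP.hardCost p) b n))
      rw [EReal.coe_ennreal_ofReal]
      exact_mod_cast le_max_left _ _
    -- Staying in arm `J` need not be optimal for these bits; any proper policy bounds the benchmark
    -- from above.
    have hinf : ((⨅ π, ⨅ _ : (SSP.hardMDP N D T).IsProper π,
        (SSP.hardMDP N D T).totalCostToGo (fun k => SSP.hardCost p (b k)) π : ℝ≥0∞) : EReal) ≤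
          ((y : ℝ) : EReal) := by
      have h1 := (iInf₂_le (f := fun π (_ : (SSP.hardMDP N D T).IsProper π) =>
        (SSP.hardMDP N D T).totalCostToGo (fun k => SSP.hardCost p (b k)) π)
        (SSP.armPolicy J 0) (SSP.isProper_hardMDP _ hD hT1)).trans_eq
          (SSP.totalCostToGo_stay hT1 b J)
      refine (EReal.coe_ennreal_le_coe_ennreal_iff.mpr h1).trans ?_
      rw [EReal.coe_ennreal_ofReal, max_eq_left hy]
    refine le_trans ?_ (EReal.sub_le_sub hcost hinf)
    exact_mod_cast hbound
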